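/- Let $(\Omega,\mathcal A,\mathbb P)$ be a probability space. For a measure $\varphi$ on $\mathbb R^d$ and $x\in\mathbb R^d$ put $\theta_x\varphi:=\varphi(\cdot+x)$; for a measure $\varphi$ on $\mathbb R^d\times\mathbb R^d$ let $\theta_x\varphi$ be the diagonal shift, $\theta_x\varphi(B\times C):=\varphi((B+x)\times(C+x))$. Spaces of measures carry the $\sigma$-field generated by the evaluations at Borel sets. Let $T$ be a stationary random transport on $\mathbb R^d$, that is, a random measure on $\mathbb R^d\times\mathbb R^d$ such that $T(\cdot\times\mathbb R^d)$ is locally finite and $\theta_xT\overset{d}{=}T$ for all $x\in\mathbb R^d$. Assume that $\Phi:=T(\cdot\times\mathbb R^d)$ is almost surely purely discrete (concentrated on its atoms; we write $x\in\Phi$ if $\Phi\{x\}>0$) and has a finite intensity $\gamma:=\mathbb E\,\Phi([0,1]^d)$. Let $L$ be a probability kernel from $\Omega\times\mathbb R^d$ to $\mathbb R^d$ with $T(\mathrm d(x,y))=L(x,\mathrm dy)\,\Phi(\mathrm dx)$ almost surely. Let $\mathbf M^1$ be the space of probability measures on $\mathbb R^d$, and let $F$ be a measurable map from $\mathbf M^1$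 to the space of probability measures on $\mathbf M^1$ such that, for all $\pi\in\mathbf M^1$ and $x\in\mathbb R^d$, $$\int \pi'(\cdot)\,F(\pi)(\mathrm d\pi')=\pi(\cdot)\quad\text{(F1)},\qquad F(\theta_x\pi)=\int \mathbf 1\{\theta_x\pi'\in\cdot\}\,F(\pi)(\mathrm d\pi')\quad\text{(F2)}.$$ Let $K$ be another probability kernel from $\Omega\times\mathbb R^d$ to $\mathbb R^d$ such that the family $\{K_x:x\in\Phi\}$, $K_x:=K(x,\cdot)$, is conditionally independent given $T$ and $$\mathbb P(K_x\in\cdot\mid T)=F(L_x),\quad x\in\Phi,\ \mathbb P\text{-a.s.}$$ (Here, since the set of atoms of $\Phi$ is random, finitely many atoms are selected by $\sigma(T)$-measurable random points $X_1,\dots,X_n$, and the two conditions are understood for $K_{X_1},\dots,K_{X_n}$, almost surely on the event that $X_1,\dots,X_n$ are pairwise distinct atoms of $\Phi$.) Assume finally that $$\mathbb E^\Phi_0\,\Phi\{0\}:=\gamma^{-1}\,\mathbb E\int_{[0,1]^d}\Phi\{x\}\,\Phi(\mathrm dx)<\infty$$ (the condition is void if $\gamma=0$). Put $K\Phi:=\int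 K(x,\cdot)\,\Phi(\mathrm dx)$ and $L\Phi:=\int L(x,\cdot)\,\Phi(\mathrm dx)$. Then $\mathbb E[K\Phi(B)^2]<\infty$ for all bounded Borel sets $B\subset\mathbb R^d$ if and only if $\mathbb E[L\Phi(B)^2]<\infty$ for all bounded Borel sets $B\subset\mathbb R^d$. In this case, for every bounded convex set $W\subset\mathbb R^d$ containing $0$ in its interior, $$\lim_{r\to\infty}\lambda_d(rW)^{-1}\operatorname{Var}[K\Phi(rW)]=\lim_{r\to\infty}\lambda_d(rW)^{-1}\operatorname{Var}[L\Phi(rW)]$$ whenever one of the two limits exists (in $[0,\infty]$), where $\lambda_d$ is Lebesgue measure on $\mathbb R^d$. -/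

import Mathlib

open MeasureTheory ProbabilityTheory Filter Topology
open scoped ENNReal Pointwise

noncomputable section

namespace Transport

/-- The Euclidean space `ℝ^d`. -/
abbrev Space (d : ℕ) : Type := EuclideanSpace ℝ (Fin d)

/-- The unit cube `[0,1]^d`. -/
def unitCube (d : ℕ) : Set (Space d) := {x | ∀ i, x i ∈ Set.Icc (0 : ℝ) 1}

variable {d : ℕ} {Ω : Type*} [MeasurableSpace Ω]

/-- The shift `θ_x φ = φ(· + x)` of a measure on `ℝ^d`. -/
def shift (x : Space d) (φ : Measure (Space d)) : Measure (Space d) :=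
  φ.map (fun y => y - x)

/-- The shift `θ_x π = π(· + x)` of a probability measure on `ℝ^d`. -/
def shiftProb (x : Space d) (π : ProbabilityMeasure (Space d)) :
    ProbabilityMeasure (Space d) :=
  π.map (f := fun y => y - x) (measurable_id.sub_const x).aemeasurable

/-- The diagonal shift, `θ_x φ (B × C) = φ ((B + x) × (C + x))`. -/
def diagShift (x : Space d) (φ : Measure (Space d × Space d)) :
    Measure (Space d × Space d) :=
  φ.map (fun p => (p.1 - x, p.2 - x))

/-- A random transport: a random measure `T` on `ℝ^d × ℝ^d` such that `T(· × ℝ^d)` is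
locally finite. The space of measures carries the `σ`-field generated by the evaluations. -/
structure IsRandomTransport (T : Ω → Measure (Space d × Space d)) : Prop where
  measurable : Measurable T
  locallyFinite : ∀ ω, IsLocallyFiniteMeasure (T ω).fst

/-- Distributional invariance of a random transport under all diagonal shifts. -/
def IsStationary (P : Measure Ω) (T : Ω → Measure (Space d × Space d)) : Prop :=
  ∀ x : Space d, P.map (fun ω => diagShift x (T ω)) = P.map T

/-- The source `Φ = T(· × ℝ^d)` of a random transport. -/
def source (T : Ω → Measure (Space d × Space d)) (ω : Ω) : Measure (Space d) :=
  (T ω).fst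

/-- A measure is purely discrete if it is concentrated on its set of atoms. -/
def IsPurelyDiscrete (φ : Measure (Space d)) : Prop := φ {x | φ {x} = 0} = 0

/-- The intensity `γ = E Φ([0,1]^d)`. -/
def intensity (P : Measure Ω) (Φ : Ω → Measure (Space d)) : ℝ≥0∞ :=
  ∫⁻ ω, Φ ω (unitCube d) ∂P

/-- The Palm expectation `E_0^Φ f(Φ) = γ⁻¹ E ∫ 1{x ∈ [0,1]^d} f(θ_x Φ) Φ(dx)` of a
nonnegative function `f` of the random measure (it is `0` in the degenerate case `γ = 0`,
in which `Φ = 0` almost surely). -/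
def palmExpectation (P : Measure Ω) (Φ : Ω → Measure (Space d))
    (f : Measure (Space d) → ℝ≥0∞) : ℝ≥0∞ :=
  (intensity P Φ)⁻¹ * ∫⁻ ω, ∫⁻ x in unitCube d, f (shift x (Φ ω)) ∂(Φ ω) ∂P

/-- The random probability measure `K_x = K(x, ·)`, as an element of `M^1(ℝ^d)`. -/
def kernelAt (K : Kernel (Ω × Space d) (Space d)) [IsMarkovKernel K] (ω : Ω) (x : Space d) :
    ProbabilityMeasure (Space d) :=
  ⟨K (ω, x), inferInstance⟩

/-- The destination `KΦ = ∫ K(x, ·) Φ(dx)`. -/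
def destination (K : Kernel (Ω × Space d) (Space d)) (Φ : Ω → Measure (Space d)) (ω : Ω) :
    Measure (Space d) :=
  (Φ ω).bind (fun x => K (ω, x))

/-- The disintegration `T(d(x,y)) = L(x,dy) Φ(dx)` almost surely, with `Φ = T(· × ℝ^d)`. -/
def Disintegrates (P : Measure Ω) (T : Ω → Measure (Space d × Space d))
    (L : Kernel (Ω × Space d) (Space d)) : Prop :=
  ∀ᵐ ω ∂P, T ω = (source T ω) ⊗ₘ (L.sectR ω)

/-- The `σ`-field `σ(T)` generated by `T`. -/
abbrev sigma (T : Ω → Measure (Space d × Space d)) : MeasurableSpace Ω :=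
  MeasurableSpace.comap T inferInstance

/-- The family `{K_x : x ∈ Φ}` is conditionally independent given `T`. As the index set (the
set of atoms of `Φ`) is random and determined by `T`, finitely many members of the family
are selected by `σ(T)`-measurable random points `X_1, …, X_n`; the product formula is required
on the event that these are pairwise distinct atoms of `Φ`. -/
def CondIndepGiven (P : Measure Ω) (T : Ω → Measure (Space d × Space d))
    (K : Kernel (Ω × Space d) (Space d)) [IsMarkovKernel K] : Prop :=
  ∀ (n : ℕ) (X : Fin n → Ω → Space d), (∀ i, Measurable[sigma T] (X i)) →
    ∀ A : Fin n → Set (ProbabilityMeasure (Space d)), (∀ i, MeasurableSet (A i)) →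
      ∀ᵐ ω ∂P, (∀ i, source T ω {X i ω} ≠ 0) → Function.Injective (fun i => X i ω) →
        (P⟦⋂ i, {ω' | kernelAt K ω' (X i ω') ∈ A i} | sigma T⟧) ω =
          ∏ i, (P⟦{ω' | kernelAt K ω' (X i ω') ∈ A i} | sigma T⟧) ω

/-- `P(K_x ∈ · | T) = F(L_x)` for `x ∈ Φ`, almost surely. The atom `x` of `Φ` is selected by a
`σ(T)`-measurable random point `X`. -/
def HasCondLawGiven (P : Measure Ω) (T : Ω → Measure (Space d × Space d))
    (K L : Kernel (Ω × Space d) (Space d)) [IsMarkovKernel K] [IsMarkovKernel L]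
    (F : Kernel (ProbabilityMeasure (Space d)) (ProbabilityMeasure (Space d))) : Prop :=
  ∀ X : Ω → Space d, Measurable[sigma T] X →
    ∀ A : Set (ProbabilityMeasure (Space d)), MeasurableSet A →
      ∀ᵐ ω ∂P, source T ω {X ω} ≠ 0 →
        (P⟦{ω' | kernelAt K ω' (X ω') ∈ A} | sigma T⟧) ω = (F (kernelAt L ω (X ω))).real A

/-- The mean value property `∫ π'(·) F(π)(dπ') = π(·)`. -/
def MeanValueProperty
    (F : Kernel (ProbabilityMeasure (Space d)) (ProbabilityMeasure (Space d))) : Prop :=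
  ∀ (π : ProbabilityMeasure (Space d)) (B : Set (Space d)), MeasurableSet B →
    ∫⁻ π', (π' : Measure (Space d)) B ∂(F π) = (π : Measure (Space d)) B

/-- The translation covariance `F(θ_x π) = ∫ 1{θ_x π' ∈ ·} F(π)(dπ')`. -/
def TranslationCovariant
    (F : Kernel (ProbabilityMeasure (Space d)) (ProbabilityMeasure (Space d))) : Prop :=
  ∀ (x : Space d) (π : ProbabilityMeasure (Space d)),
    F (shiftProb x π) = (F π).map (shiftProb x)

/-- `E Ψ(B)^2 < ∞` for all bounded Borel sets `B`. -/
def LocallySquareIntegrable (P : Measure Ω) (Ψ : Ω → Measure (Space d)) : Prop :=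
  ∀ B : Set (Space d), MeasurableSet B → Bornology.IsBounded B → ∫⁻ ω, (Ψ ω B) ^ 2 ∂P < ∞

/-- Bounded convex sets containing the origin in their interior. -/
def IsWindow (W : Set (Space d)) : Prop :=
  Convex ℝ W ∧ Bornology.IsBounded W ∧ (0 : Space d) ∈ interior W

/-- The normalized variance `λ_d(rW)⁻¹ Var[Ψ(rW)]`. -/
def normalizedVariance (P : Measure Ω) (Ψ : Ω → Measure (Space d)) (W : Set (Space d))
    (r : ℝ) : ℝ :=
  (volume.real (r • W))⁻¹ * Var[fun ω => (Ψ ω).real (r • W); P]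

/-- `l` is the asymptotic variance of `Ψ` with respect to `W` (infinite values allowed). -/
def HasAsymptoticVariance (P : Measure Ω) (Ψ : Ω → Measure (Space d)) (W : Set (Space d))
    (l : EReal) : Prop :=
  Tendsto (fun r : ℝ => (normalizedVariance P Ψ W r : EReal)) atTop (𝓝 l)

end Transport

end

/-! Enumerate the atoms of `Φ` by measurable functions `X_k` of `T`, with weights `w_k` that vanish
on repetitions. Then `KΦ(B) = ∑ w_k K_{X_k}(B)`, so the second moment is a double sum of terms
`E[w_j w_k K_{X_j}(B) K_{X_k}(B)]`, and likewise for `L`. All terms are nonnegative, so no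
integrability is needed to compare them.

For `j ≠ k`, conditional independence and the mean value property (F1) allow `K` to be replaced by
`L` (`lintegral_offDiag_eq`). On the diagonal, `K_x(B)²` has conditional mean `∫ π'(B)²
F(L_x)(dπ')`. By Jensen this is at least `L_x(B)²`, and since `π'(B)² ≤ π'(B)` it is at most `L_x(B)
= L_x(B)² + L_x(B) L_x(Bᶜ)`. Hence `0 ≤ E[KΦ(B)²] - E[LΦ(B)²] ≤ V(B)` with `V(B) = E ∫ Φ{x} L_x(B)
L_x(Bᶜ) Φ(dx)` whenever the `L` moment is finite. The first moments agree, so the same bounds hold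
for the variances.

To control `V(B)`, consider pairs of transported points `(x,y)`, `(x,z)` with common source. Their
mean measure is invariant under diagonal shifts, and mass transport gives `V(B) = ∫ λ{s : y+s ∈ B,
z+s ∉ B} dN`, where `N` keeps only sources in the unit cube. The Palm condition says that `N` is
finite. Thus `V(B) ≤ λ(B) N(univ)`, which transfers local square integrability. Moreover
`V(rU)/λ(rU) → 0` for bounded open nonempty `U` by dominated convergence, because a fixed
displacement `z - y` is negligible at scale `r`. -/

noncomputable section

namespace Transport

/-! ### S-finiteness of kernels and joint measurability of point masses. -/

section Kernels

variable {α β : Type*} [MeasurableSpace α] [MeasurableSpace β]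

/-- A kernel with finite values is s-finite. -/
theorem isSFiniteKernel_of_univ_lt_top (κ : Kernel α β) (h : ∀ a, κ a Set.univ < ∞) :
    IsSFiniteKernel κ := by
  classical
  -- Level sets of the integer part of the total mass: on `D m` the kernel is bounded by `m + 1`.
  let D : ℕ → Set α := fun m => {a | ⌊(κ a Set.univ).toNNReal⌋₊ = m}
  have hD : ∀ m, MeasurableSet (D m) := fun m =>
    (Nat.measurable_floor.comp (κ.measurable_coe MeasurableSet.univ).ennreal_toNNReal)
      (measurableSet_singleton m)
  refine ⟨fun m => Kernel.piecewise (hD m) κ 0, fun m => ⟨(m + 1 : ℝ≥0∞), by finiteness, ?_⟩, ?_⟩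
  · intro a
    rw [Kernel.piecewise_apply]
    split_ifs with ha
    · have h1 : (κ a Set.univ).toNNReal < (m : NNReal) + 1 := by
        have := Nat.lt_floor_add_one (κ a Set.univ).toNNReal
        rwa [show ⌊(κ a Set.univ).toNNReal⌋₊ = m from ha] at this
      rw [← ENNReal.coe_toNNReal (h a).ne]
      exact_mod_cast h1.le
    · simp
  · ext a s hs
    rw [Kernel.sum_apply' _ _ hs, tsum_eq_single ⌊(κ a Set.univ).toNNReal⌋₊]
    · rw [Kernel.piecewise_apply, if_pos (show a ∈ D _ from rfl)]
    · intro m hm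
      rw [Kernel.piecewise_apply, if_neg (fun ha : a ∈ D m => hm ha.symm)]
      simp

/-- A kernel which is finite on the members of a countable measurable cover is s-finite. -/
theorem isSFiniteKernel_of_cover (κ : Kernel α β) (s : ℕ → Set β) (hs : ∀ n, MeasurableSet (s n))
    (hU : ⋃ n, s n = Set.univ) (h : ∀ a n, κ a (s n) < ∞) : IsSFiniteKernel κ := by
  have hd : ∀ n, MeasurableSet (disjointed s n) := fun n => MeasurableSet.disjointed hs n
  have hκ : κ = Kernel.sum fun n => κ.restrict (hd n) := by
    ext a t ht
    rw [Kernel.sum_apply' _ _ ht]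
    simp_rw [Kernel.restrict_apply' _ _ _ ht]
    rw [← measure_iUnion _ fun n => ht.inter (hd n), ← Set.inter_iUnion, iUnion_disjointed, hU,
      Set.inter_univ]
    exact fun i j hij => ((disjoint_disjointed s) hij).mono Set.inter_subset_right
      Set.inter_subset_right
  rw [hκ]
  refine Kernel.isSFiniteKernel_sum (hκs := fun n => isSFiniteKernel_of_univ_lt_top _ fun a => ?_)
  rw [Kernel.restrict_apply' _ _ _ MeasurableSet.univ, Set.univ_inter]
  exact (measure_mono (disjointed_subset s n)).trans_lt (h a n)

theorem measurable_singleton_mass {α E : Type*} [MeasurableSpace α] [MeasurableSpace E]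
    [MeasurableEq E] (κ : Kernel α E) [IsSFiniteKernel κ] :
    Measurable fun p : α × E => κ p.1 {p.2} := by
  have h : MeasurableSet {q : (α × E) × E | q.1.2 = q.2} :=
    measurableSet_eq_fun (measurable_snd.comp measurable_fst) measurable_snd
  have := Kernel.measurable_kernel_prodMk_left (κ := κ.comap Prod.fst measurable_fst) h
  convert this using 2 with p
  rw [Kernel.comap_apply]
  congr 1
  ext x
  simp [eq_comm]

end Kernels

/-! ### Enumeration of a countable basis. -/

section Basis

variable (E : Type*) [TopologicalSpace E] [SecondCountableTopology E]

/-- An enumeration of a countable basis of the topology. -/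
def basisSeq : ℕ → Set E :=
  Set.enumerateCountable (TopologicalSpace.countable_countableBasis E) ∅

theorem isOpen_basisSeq (k : ℕ) : IsOpen (basisSeq E k) := by
  have h := Set.range_enumerateCountable_subset (TopologicalSpace.countable_countableBasis E) ∅
    (Set.mem_range_self k)
  rcases h with h | h
  · rw [basisSeq, h]; exact isOpen_empty
  · exact TopologicalSpace.isOpen_of_mem_countableBasis h

end Basis

/-! ### Selection of atoms by basis sets. -/

section Atoms

variable {E : Type*} [MeasurableSpace E] [Zero E]

/-- The points of `C` which carry more than half of the mass of `C`. -/
def dominantAtoms (φ : Measure E) (C : Set E) : Set E := {x | x ∈ C ∧ φ C < 2 * φ {x}}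

open Classical in
/-- The point of `C` which carries more than half of the mass of `C`, if it exists. -/
def dominantAtom (φ : Measure E) (C : Set E) : E :=
  if h : (dominantAtoms φ C).Nonempty then h.some else 0

variable [TopologicalSpace E] [SecondCountableTopology E]

/-- A sequence of points which exhausts the atoms of a locally finite measure. -/
def atomSeq (φ : Measure E) (k : ℕ) : E := dominantAtom φ (basisSeq E k)

/-- The `k`-th point of `atomSeq` is an atom which did not occur before. -/
def IsNewAtom (φ : Measure E) (k : ℕ) : Prop :=
  φ {atomSeq φ k} ≠ 0 ∧ ∀ j < k, atomSeq φ j ≠ atomSeq φ k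

open Classical in
/-- The mass of the `k`-th point of `atomSeq`, set to zero if the point occurred before. -/
def atomWeight (φ : Measure E) (k : ℕ) : ℝ≥0∞ :=
  if IsNewAtom φ k then φ {atomSeq φ k} else 0

theorem isNewAtom_of_atomWeight_ne_zero {φ : Measure E} {k : ℕ} (h : atomWeight φ k ≠ 0) :
    IsNewAtom φ k := by
  by_contra hn
  exact h (if_neg hn)

theorem IsNewAtom.ne {φ : Measure E} {j k : ℕ} (hj : IsNewAtom φ j) (hk : IsNewAtom φ k)
    (hjk : j ≠ k) : atomSeq φ j ≠ atomSeq φ k := by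
  rcases lt_or_gt_of_ne hjk with h | h
  · exact hk.2 j h
  · exact (hj.2 k h).symm

end Atoms

/-! ### Measurable enumeration of the atoms and discrete integration. -/

section AtomsMeasurable

variable {E : Type*} [MeasurableSpace E] [MeasurableSingletonClass E]

theorem subsingleton_dominantAtoms (φ : Measure E) (C : Set E) :
    (dominantAtoms φ C).Subsingleton := by
  rintro x ⟨hxC, hx⟩ y ⟨hyC, hy⟩
  by_contra hxy
  have h1 : φ {x} + φ {y} ≤ φ C := by
    rw [← measure_union (Set.disjoint_singleton.2 hxy) (measurableSet_singleton y)]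
    exact measure_mono (by simp [Set.insert_subset_iff, hxC, hyC])
  have h2 : φ C + φ C < 2 * φ {x} + 2 * φ {y} := ENNReal.add_lt_add hx hy
  rw [← mul_add, ← two_mul] at h2
  exact absurd (mul_le_mul_right h1 2) (not_le.2 h2)

variable [Zero E]

theorem dominantAtom_eq {φ : Measure E} {C : Set E} {x : E} (hx : x ∈ dominantAtoms φ C) :
    dominantAtom φ C = x := by
  have h : (dominantAtoms φ C).Nonempty := ⟨x, hx⟩
  rw [dominantAtom, dif_pos h]
  exact subsingleton_dominantAtoms φ C h.some_mem hx

variable {α : Type*} [MeasurableSpace α]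

/-- A dominant atom has positive mass, so existence of one in `A` is equivalent to positive mass of
the set of dominant atoms in `A`. This replaces a projection, which need not be measurable, by a
kernel integral. -/
theorem measurable_dominantAtom [MeasurableEq E] (κ : Kernel α E) [IsSFiniteKernel κ]
    {C : Set E} (hC : MeasurableSet C) : Measurable fun a => dominantAtom (κ a) C := by
  classical
  have hset : MeasurableSet {p : α × E | p.2 ∈ dominantAtoms (κ p.1) C} :=
    (measurable_snd hC).inter (measurableSet_lt ((κ.measurable_coe hC).comp measurable_fst)
      ((measurable_singleton_mass κ).const_mul 2))
  have key : ∀ A : Set E, MeasurableSet A →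
      MeasurableSet {a | (dominantAtoms (κ a) C ∩ A).Nonempty} := by
    intro A hA
    have h1 := Kernel.measurable_kernel_prodMk_left (κ := κ) (hset.inter (measurable_snd hA))
    have h2 : {a | (dominantAtoms (κ a) C ∩ A).Nonempty} =
        {a | κ a (Prod.mk a ⁻¹' ({p : α × E | p.2 ∈ dominantAtoms (κ p.1) C} ∩
          Prod.snd ⁻¹' A)) ≠ 0} := by
      ext a
      have h3 : Prod.mk a ⁻¹' ({p : α × E | p.2 ∈ dominantAtoms (κ p.1) C} ∩ Prod.snd ⁻¹' A) =
        dominantAtoms (κ a) C ∩ A := rfl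
      rw [Set.mem_ofPred_eq, Set.mem_ofPred_eq, h3]
      constructor
      · rintro ⟨x, hx, hxA⟩ h0
        have h4 : κ a {x} = 0 :=
          measure_mono_null (Set.singleton_subset_iff.2
            (show x ∈ dominantAtoms (κ a) C ∩ A from ⟨hx, hxA⟩)) h0
        have h5 := hx.2
        simp [h4] at h5
      · exact nonempty_of_measure_ne_zero
    rw [h2]
    exact (measurableSet_eq_fun h1 measurable_const).compl
  intro A hA
  -- The second set accounts for the default value `0` taken when there is no dominant atom.
  have h : (fun a => dominantAtom (κ a) C) ⁻¹' A =
      {a | (dominantAtoms (κ a) C ∩ A).Nonempty} ∪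
        ({a | (dominantAtoms (κ a) C ∩ Set.univ).Nonempty}ᶜ ∩ {_a | (0 : E) ∈ A}) := by
    ext a
    by_cases hne : (dominantAtoms (κ a) C).Nonempty
    · obtain ⟨x, hx⟩ := hne
      have h1 : (dominantAtoms (κ a) C ∩ A).Nonempty ↔ x ∈ A :=
        ⟨fun ⟨y, hy, hyA⟩ => subsingleton_dominantAtoms _ _ hy hx ▸ hyA, fun h => ⟨x, hx, h⟩⟩
      have h2 : (dominantAtoms (κ a) C).Nonempty := ⟨x, hx⟩
      simp [dominantAtom_eq hx, h1, h2]
    · have h1 : ¬ (dominantAtoms (κ a) C ∩ A).Nonempty := fun h => hne h.left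
      simp [dominantAtom, hne, h1]
  rw [h]
  exact (key A hA).union ((key _ MeasurableSet.univ).compl.inter (MeasurableSet.const _))

variable [TopologicalSpace E] [SecondCountableTopology E]

/-- Outer regularity provides an open set around `x` of mass below `2 φ {x}`; a basis set between
them has `x` as its dominant atom. The least such index is the new one. -/
theorem exists_atomSeq_eq (φ : Measure E) [φ.OuterRegular] {x : E} (hx : φ {x} ≠ 0)
    (hx' : φ {x} ≠ ∞) : ∃ k, IsNewAtom φ k ∧ atomSeq φ k = x := by
  classical
  have h1 : φ {x} < 2 * φ {x} := by
    rw [two_mul]; exact ENNReal.lt_add_right hx' hx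
  obtain ⟨U, hxU, hU, hφU⟩ := Set.exists_isOpen_lt_of_lt _ _ h1
  obtain ⟨v, hv, hxv, hvU⟩ := (TopologicalSpace.isBasis_countableBasis E).exists_subset_of_mem_open
    (Set.singleton_subset_iff.1 hxU) hU
  obtain ⟨k, hk⟩ := Set.subset_range_enumerate
    (TopologicalSpace.countable_countableBasis E) ∅ hv
  have hex : ∃ k, atomSeq φ k = x :=
    ⟨k, dominantAtom_eq (by
      rw [basisSeq, hk]; exact ⟨hxv, (measure_mono hvU).trans_lt hφU⟩)⟩
  refine ⟨Nat.find hex, ⟨?_, fun j hj hjx => ?_⟩, Nat.find_spec hex⟩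
  · rwa [Nat.find_spec hex]
  · exact Nat.find_min hex hj (hjx.trans (Nat.find_spec hex))

/-- Integration with respect to a purely discrete measure. -/
theorem lintegral_eq_tsum_atoms (φ : Measure E) [φ.OuterRegular] (hfin : ∀ x, φ {x} ≠ ∞)
    (hd : φ {x | φ {x} = 0} = 0) (f : E → ℝ≥0∞) :
    ∫⁻ x, f x ∂φ = ∑' k, atomWeight φ k * f (atomSeq φ k) := by
  classical
  -- These sets are disjoint, since repetitions are discarded, and cover all atoms, hence almost
  -- every point.
  let s : ℕ → Set E := fun k => if IsNewAtom φ k then {atomSeq φ k} else ∅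
  have hs : ∀ k, MeasurableSet (s k) := fun k => by
    simp only [s]; split_ifs
    · exact measurableSet_singleton _
    · exact MeasurableSet.empty
  have hdisj : Pairwise (Function.onFun Disjoint s) := by
    intro j k hjk
    simp only [Function.onFun, s]
    split_ifs with h1 h2
    · exact Set.disjoint_singleton.2 (h1.ne h2 hjk)
    all_goals simp
  have hae : ∀ᵐ x ∂φ, x ∈ ⋃ k, s k := by
    rw [ae_iff]
    refine measure_mono_null (fun x hx => ?_) hd
    by_contra hx0
    obtain ⟨k, hk, rfl⟩ := exists_atomSeq_eq φ hx0 (hfin x)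
    exact hx (Set.mem_iUnion.2 ⟨k, by simp [s, hk]⟩)
  rw [← Measure.restrict_eq_self_of_ae_mem hae, lintegral_iUnion hs hdisj,
    Measure.restrict_eq_self_of_ae_mem hae]
  refine tsum_congr fun k => ?_
  simp only [s, atomWeight]
  split_ifs
  · rw [lintegral_singleton, mul_comm]
  · simp

variable [MeasurableEq E] [OpensMeasurableSpace E]

theorem measurable_atomSeq (κ : Kernel α E) [IsSFiniteKernel κ] (k : ℕ) :
    Measurable fun a => atomSeq (κ a) k :=
  measurable_dominantAtom κ (isOpen_basisSeq E k).measurableSet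

theorem measurable_mass_atomSeq (κ : Kernel α E) [IsSFiniteKernel κ] (k : ℕ) :
    Measurable fun a => κ a {atomSeq (κ a) k} :=
  (measurable_singleton_mass κ).comp (measurable_id.prodMk (measurable_atomSeq κ k))

theorem measurableSet_isNewAtom (κ : Kernel α E) [IsSFiniteKernel κ] (k : ℕ) :
    MeasurableSet {a | IsNewAtom (κ a) k} := by
  have h : {a | IsNewAtom (κ a) k} = {a | κ a {atomSeq (κ a) k} = 0}ᶜ ∩
      ⋂ j : ℕ, ⋂ (_ : j < k), {a | atomSeq (κ a) j = atomSeq (κ a) k}ᶜ := by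
    ext a
    simp [IsNewAtom]
  rw [h]
  refine (measurable_mass_atomSeq κ k (measurableSet_singleton 0)).compl.inter
    (MeasurableSet.iInter fun j => MeasurableSet.iInter fun _ => ?_)
  exact (measurableSet_eq_fun (measurable_atomSeq κ j) (measurable_atomSeq κ k)).compl

theorem measurable_atomWeight (κ : Kernel α E) [IsSFiniteKernel κ] (k : ℕ) :
    Measurable fun a => atomWeight (κ a) k := by
  classical
  exact Measurable.ite (measurableSet_isNewAtom κ k) (measurable_mass_atomSeq κ k)
    measurable_const

end AtomsMeasurable


/-! ### From conditional probabilities to integrals. -/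

section CondProb

variable {Ω : Type*} {m m0 : MeasurableSpace Ω}

/-- The conditional laws are prescribed only on the event that the selected points are (distinct)
atoms. Integration over such an event `G` of the conditioning `σ`-field yields an unconditional
identity. -/
theorem measure_inter_eq_setLIntegral_of_condProb (P : Measure Ω) [IsProbabilityMeasure P]
    (hm : m ≤ m0) {s G : Set Ω} (hs : MeasurableSet s) (hG : MeasurableSet[m] G) {f : Ω → ℝ≥0∞}
    (hf : Measurable f) (hf1 : ∀ ω, f ω ≤ 1)
    (h : ∀ᵐ ω ∂P, ω ∈ G → (P⟦s | m⟧) ω = (f ω).toReal) :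
    P (G ∩ s) = ∫⁻ ω in G, f ω ∂P := by
  have hG0 : MeasurableSet G := hm G hG
  have h1 : ∫ ω in G, (P⟦s | m⟧) ω ∂P = P.real (G ∩ s) := by
    rw [setIntegral_condExp hm ((integrable_const _).indicator hs) hG,
      setIntegral_indicator hs]
    simp
  have h2 : ∫ ω in G, (P⟦s | m⟧) ω ∂P = ∫ ω in G, (f ω).toReal ∂P :=
    setIntegral_congr_ae hG0 h
  rw [h2, integral_toReal hf.aemeasurable
    (ae_of_all _ fun ω => (hf1 ω).trans_lt ENNReal.one_lt_top)] at h1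
  have h3 : ∫⁻ ω in G, f ω ∂P ≠ ∞ := by
    refine ((setLIntegral_mono measurable_const fun ω _ => hf1 ω).trans_lt ?_).ne
    simp
  exact ((ENNReal.toReal_eq_toReal_iff' h3 (measure_ne_top _ _)).1 h1).symm

end CondProb

/-! ### Integration against a joint law on an event. -/

section JointLaw

variable {Ω Θ Y : Type*} [MeasurableSpace Ω] [MeasurableSpace Θ] [MeasurableSpace Y]

theorem lintegral_mul_eq_of_map_eq (P : Measure Ω) [SFinite P] {T : Ω → Θ} (hT : Measurable T)
    {V : Ω → Y} (hV : Measurable V) (η : Kernel Ω Y) [IsSFiniteKernel η] {E : Set Θ}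
    (hE : MeasurableSet E)
    (h : (P.restrict (T ⁻¹' E)).map (fun ω => (T ω, V ω)) =
      ((P.restrict (T ⁻¹' E)) ⊗ₘ η).map fun p => (T p.1, p.2))
    {w : Θ → ℝ≥0∞} (hw : Measurable w) (hwE : ∀ t, w t ≠ 0 → t ∈ E) {f : Y → ℝ≥0∞}
    (hf : Measurable f) :
    ∫⁻ ω, w (T ω) * f (V ω) ∂P = ∫⁻ ω, w (T ω) * ∫⁻ y, f y ∂(η ω) ∂P := by
  have hg : Measurable fun p : Θ × Y => w p.1 * f p.2 := by fun_prop
  have h0 : ∀ g : Ω → ℝ≥0∞, ∫⁻ ω in T ⁻¹' E, w (T ω) * g ω ∂P = ∫⁻ ω, w (T ω) * g ω ∂P := by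
    intro g
    rw [← lintegral_indicator (hT hE)]
    refine lintegral_congr fun ω => ?_
    by_cases hω : ω ∈ T ⁻¹' E
    · rw [Set.indicator_of_mem hω]
    · rw [Set.indicator_of_notMem hω]
      have : w (T ω) = 0 := by
        by_contra hne
        exact hω (hwE _ hne)
      simp [this]
  have h1 := congrArg (fun ν => ∫⁻ p, w p.1 * f p.2 ∂ν) h
  beta_reduce at h1
  rw [lintegral_map hg (by fun_prop), lintegral_map hg (by fun_prop),
    Measure.lintegral_compProd (by fun_prop), h0] at h1
  rw [h1, ← h0]
  refine lintegral_congr fun ω => ?_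
  exact lintegral_const_mul (w (T ω)) hf

end JointLaw

/-! ### Joint laws of `T` with one or two of the kernels `K_x`. -/

section Conditional

variable {d : ℕ} {Ω : Type*} [MeasurableSpace Ω] {P : Measure Ω} [IsProbabilityMeasure P]
  {T : Ω → Measure (Space d × Space d)} {K L : Kernel (Ω × Space d) (Space d)}
  [IsMarkovKernel K] [IsMarkovKernel L]
  {F : Kernel (ProbabilityMeasure (Space d)) (ProbabilityMeasure (Space d))} [IsMarkovKernel F]

theorem measurable_kernelAt (K : Kernel (Ω × Space d) (Space d)) [IsMarkovKernel K]
    {x : Ω → Space d} (hx : Measurable x) : Measurable fun ω => kernelAt K ω (x ω) :=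
  (K.measurable.comp (measurable_id.prodMk hx)).subtype_mk

theorem measure_inter_kernelAt (hT : Measurable T) (hlaw : HasCondLawGiven P T K L F)
    {x : Measure (Space d × Space d) → Space d} (hx : Measurable x)
    {E : Set (Measure (Space d × Space d))} (hE : MeasurableSet E)
    (hEx : ∀ t ∈ E, t.fst {x t} ≠ 0)
    {A : Set (ProbabilityMeasure (Space d))} (hA : MeasurableSet A) :
    P (T ⁻¹' E ∩ {ω | kernelAt K ω (x (T ω)) ∈ A}) =
      ∫⁻ ω in T ⁻¹' E, F (kernelAt L ω (x (T ω))) A ∂P := by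
  refine measure_inter_eq_setLIntegral_of_condProb P (m := sigma T) hT.comap_le
    (measurable_kernelAt K (hx.comp hT) hA) ⟨E, hE, rfl⟩
    ((F.measurable_coe hA).comp (measurable_kernelAt L (hx.comp hT))) (fun ω => prob_le_one) ?_
  filter_upwards [hlaw (x ∘ T) (hx.comp (comap_measurable T)) A hA] with ω hω hωE
  exact hω (hEx _ hωE)

theorem measure_inter_kernelAt_pair (hT : Measurable T) (hlaw : HasCondLawGiven P T K L F)
    (hindep : CondIndepGiven P T K)
    {x y : Measure (Space d × Space d) → Space d} (hx : Measurable x) (hy : Measurable y)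
    {E : Set (Measure (Space d × Space d))} (hE : MeasurableSet E)
    (hEx : ∀ t ∈ E, t.fst {x t} ≠ 0) (hEy : ∀ t ∈ E, t.fst {y t} ≠ 0)
    (hExy : ∀ t ∈ E, x t ≠ y t)
    {A B : Set (ProbabilityMeasure (Space d))} (hA : MeasurableSet A) (hB : MeasurableSet B) :
    P (T ⁻¹' E ∩ ({ω | kernelAt K ω (x (T ω)) ∈ A} ∩ {ω | kernelAt K ω (y (T ω)) ∈ B})) =
      ∫⁻ ω in T ⁻¹' E, F (kernelAt L ω (x (T ω))) A * F (kernelAt L ω (y (T ω))) B ∂P := by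
  refine measure_inter_eq_setLIntegral_of_condProb P (m := sigma T) hT.comap_le
    ((measurable_kernelAt K (hx.comp hT) hA).inter (measurable_kernelAt K (hy.comp hT) hB))
    ⟨E, hE, rfl⟩
    (((F.measurable_coe hA).comp (measurable_kernelAt L (hx.comp hT))).mul
      ((F.measurable_coe hB).comp (measurable_kernelAt L (hy.comp hT))))
    (fun ω => mul_le_one' prob_le_one prob_le_one) ?_
  -- Pairwise independence suffices for second moments, so only `n = 2` is needed.
  have h2 := hindep 2 ![x ∘ T, y ∘ T]
    (Fin.forall_fin_two.2 ⟨hx.comp (comap_measurable T), hy.comp (comap_measurable T)⟩)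
    ![A, B] (Fin.forall_fin_two.2 ⟨hA, hB⟩)
  have hset : (⋂ i, {ω' | kernelAt K ω' ((![x ∘ T, y ∘ T] : Fin 2 → Ω → Space d) i ω') ∈
      (![A, B] : Fin 2 → Set (ProbabilityMeasure (Space d))) i}) =
      {ω | kernelAt K ω (x (T ω)) ∈ A} ∩ {ω | kernelAt K ω (y (T ω)) ∈ B} := by
    ext ω
    simp [Fin.forall_fin_two]
  rw [hset] at h2
  filter_upwards [h2, hlaw (x ∘ T) (hx.comp (comap_measurable T)) A hA,
    hlaw (y ∘ T) (hy.comp (comap_measurable T)) B hB] with ω hω hωA hωB hωE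
  refine (hω (Fin.forall_fin_two.2 ⟨hEx _ hωE, hEy _ hωE⟩) ?_).trans ?_
  rotate_left
  · rw [Fin.prod_univ_two, ENNReal.toReal_mul]
    exact congrArg₂ _ (hωA (hEx _ hωE)) (hωB (hEy _ hωE))
  · intro i j hij
    have h3 := hExy _ hωE
    fin_cases i <;> fin_cases j
    · rfl
    · exact absurd hij h3
    · exact absurd hij h3.symm
    · rfl

/-- The conditional law of `K` at a `T`-measurable atom. -/
theorem lintegral_kernelAt (hT : Measurable T) (hlaw : HasCondLawGiven P T K L F)
    {x : Measure (Space d × Space d) → Space d} (hx : Measurable x)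
    {E : Set (Measure (Space d × Space d))} (hE : MeasurableSet E)
    (hEx : ∀ t ∈ E, t.fst {x t} ≠ 0)
    {w : Measure (Space d × Space d) → ℝ≥0∞} (hw : Measurable w) (hwE : ∀ t, w t ≠ 0 → t ∈ E)
    {f : ProbabilityMeasure (Space d) → ℝ≥0∞} (hf : Measurable f) :
    ∫⁻ ω, w (T ω) * f (kernelAt K ω (x (T ω))) ∂P =
      ∫⁻ ω, w (T ω) * ∫⁻ π, f π ∂(F (kernelAt L ω (x (T ω)))) ∂P := by
  have hV := measurable_kernelAt K (hx.comp hT)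
  refine lintegral_mul_eq_of_map_eq P hT hV
    (F.comap (fun ω => kernelAt L ω (x (T ω))) (measurable_kernelAt L (hx.comp hT))) hE
    ?_ hw hwE hf
  refine Measure.ext_prod fun {G A} hG hA => ?_
  have h1 := measure_inter_kernelAt hT hlaw hx (hE.inter hG) (fun t ht => hEx t ht.1) hA
  rw [Measure.map_apply (hT.prodMk hV) (hG.prod hA), Measure.map_apply (by fun_prop) (hG.prod hA),
    Measure.restrict_apply (hT.prodMk hV (hG.prod hA))]
  rw [show (fun p : Ω × ProbabilityMeasure (Space d) => (T p.1, p.2)) ⁻¹' (G ×ˢ A) =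
    (T ⁻¹' G) ×ˢ A from rfl, Measure.compProd_apply_prod (hT hG) hA,
    Measure.restrict_restrict (hT hG), ← Set.preimage_inter, Set.inter_comm G E]
  refine Eq.trans (congrArg P ?_) h1
  ext ω
  simp only [Set.mem_inter_iff, Set.mem_preimage, Set.mem_prod, Set.mem_ofPred_eq]
  tauto

/-- The conditional law of `K` at a pair of distinct `T`-measurable atoms. -/
theorem lintegral_kernelAt_pair (hT : Measurable T) (hlaw : HasCondLawGiven P T K L F)
    (hindep : CondIndepGiven P T K)
    {x y : Measure (Space d × Space d) → Space d} (hx : Measurable x) (hy : Measurable y)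
    {E : Set (Measure (Space d × Space d))} (hE : MeasurableSet E)
    (hEx : ∀ t ∈ E, t.fst {x t} ≠ 0) (hEy : ∀ t ∈ E, t.fst {y t} ≠ 0)
    (hExy : ∀ t ∈ E, x t ≠ y t)
    {w : Measure (Space d × Space d) → ℝ≥0∞} (hw : Measurable w) (hwE : ∀ t, w t ≠ 0 → t ∈ E)
    {f g : ProbabilityMeasure (Space d) → ℝ≥0∞} (hf : Measurable f) (hg : Measurable g) :
    ∫⁻ ω, w (T ω) * (f (kernelAt K ω (x (T ω))) * g (kernelAt K ω (y (T ω)))) ∂P =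
      ∫⁻ ω, w (T ω) * ((∫⁻ π, f π ∂(F (kernelAt L ω (x (T ω))))) *
        ∫⁻ π, g π ∂(F (kernelAt L ω (y (T ω))))) ∂P := by
  have hV := (measurable_kernelAt K (hx.comp hT)).prodMk (measurable_kernelAt K (hy.comp hT))
  have hfg : Measurable fun p : ProbabilityMeasure (Space d) × ProbabilityMeasure (Space d) =>
    f p.1 * g p.2 := by fun_prop
  let η := (F.comap (fun ω => kernelAt L ω (x (T ω))) (measurable_kernelAt L (hx.comp hT))).prod
    (F.comap (fun ω => kernelAt L ω (y (T ω))) (measurable_kernelAt L (hy.comp hT)))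
  have key := lintegral_mul_eq_of_map_eq P hT hV η hE ?_ hw hwE hfg
  · refine key.trans (lintegral_congr fun ω => ?_)
    rw [Kernel.prod_apply, Kernel.comap_apply, Kernel.comap_apply,
      lintegral_prod_mul hf.aemeasurable hg.aemeasurable]
  refine Measure.ext_prod₃ fun {G A B} hG hA hB => ?_
  have h1 := measure_inter_kernelAt_pair hT hlaw hindep hx hy (hE.inter hG)
    (fun t ht => hEx t ht.1) (fun t ht => hEy t ht.1) (fun t ht => hExy t ht.1) hA hB
  have hGAB := hG.prod (hA.prod hB)
  rw [Measure.map_apply (hT.prodMk hV) hGAB, Measure.map_apply (by fun_prop) hGAB,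
    Measure.restrict_apply (hT.prodMk hV hGAB)]
  rw [show (fun p : Ω × ProbabilityMeasure (Space d) × ProbabilityMeasure (Space d) =>
    (T p.1, p.2)) ⁻¹' (G ×ˢ A ×ˢ B) = (T ⁻¹' G) ×ˢ (A ×ˢ B) from rfl,
    Measure.compProd_apply_prod (hT hG) (hA.prod hB),
    Measure.restrict_restrict (hT hG), ← Set.preimage_inter, Set.inter_comm G E]
  refine Eq.trans (congrArg P ?_) (h1.trans (lintegral_congr fun ω => ?_))
  · ext ω
    simp only [Set.mem_inter_iff, Set.mem_preimage, Set.mem_prod, Set.mem_ofPred_eq]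
    tauto
  · rw [Kernel.prod_apply_prod, Kernel.comap_apply, Kernel.comap_apply]

end Conditional


/-! ### The transport as an s-finite kernel on the space of measures. -/

section CanonicalKernel

variable (d : ℕ)

/-- The measures whose first marginal is finite on balls. -/
def fstBallFinite : Set (Measure (Space d × Space d)) :=
  {μ | ∀ n : ℕ, μ (Metric.closedBall 0 (n : ℝ) ×ˢ Set.univ) < ∞}

theorem measurableSet_closedBall_prod_univ (n : ℕ) :
    MeasurableSet (Metric.closedBall (0 : Space d) (n : ℝ) ×ˢ (Set.univ : Set (Space d))) :=
  Metric.isClosed_closedBall.measurableSet.prod MeasurableSet.univ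

theorem measurableSet_fstBallFinite : MeasurableSet (fstBallFinite d) := by
  have h : fstBallFinite d =
      ⋂ n : ℕ, {μ | μ (Metric.closedBall 0 (n : ℝ) ×ˢ Set.univ) < ∞} := by
    ext μ
    simp [fstBallFinite]
  rw [h]
  exact MeasurableSet.iInter fun n => measurableSet_lt
    (Measure.measurable_coe (measurableSet_closedBall_prod_univ d n)) measurable_const

open Classical in
/-- The tautological kernel from the space of measures, set to zero outside the measures whose
first marginal is finite on balls. -/
def transportKernel : Kernel (Measure (Space d × Space d)) (Space d × Space d) :=
  Kernel.piecewise (measurableSet_fstBallFinite d) ⟨id, measurable_id⟩ 0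

variable {d}

theorem transportKernel_apply_of_mem {μ : Measure (Space d × Space d)}
    (h : μ ∈ fstBallFinite d) : transportKernel d μ = μ := by
  classical
  rw [transportKernel, Kernel.piecewise_apply, if_pos h]
  rfl

theorem transportKernel_apply_of_notMem {μ : Measure (Space d × Space d)}
    (h : μ ∉ fstBallFinite d) : transportKernel d μ = 0 := by
  classical
  rw [transportKernel, Kernel.piecewise_apply, if_neg h]
  rfl

instance : IsSFiniteKernel (transportKernel d) := by
  refine isSFiniteKernel_of_cover _
    (fun n : ℕ => Metric.closedBall (0 : Space d) (n : ℝ) ×ˢ Set.univ)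
    (measurableSet_closedBall_prod_univ d) ?_ fun μ n => ?_
  · rw [← Set.iUnion_prod_const, Metric.iUnion_closedBall_nat, Set.univ_prod_univ]
  · by_cases h : μ ∈ fstBallFinite d
    · rw [transportKernel_apply_of_mem h]
      exact h n
    · simp [transportKernel_apply_of_notMem h]

theorem mem_fstBallFinite (μ : Measure (Space d × Space d)) [IsLocallyFiniteMeasure μ.fst] :
    μ ∈ fstBallFinite d := by
  intro n
  have h : μ.fst (Metric.closedBall (0 : Space d) (n : ℝ)) < ∞ :=
    (isCompact_closedBall 0 (n : ℝ)).measure_lt_top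
  rw [Measure.fst_apply Metric.isClosed_closedBall.measurableSet] at h
  rwa [Set.prod_univ]

/-- The first marginal of the tautological kernel. -/
abbrev sourceKernel (d : ℕ) : Kernel (Measure (Space d × Space d)) (Space d) :=
  (transportKernel d).fst

theorem sourceKernel_apply (μ : Measure (Space d × Space d)) [IsLocallyFiniteMeasure μ.fst] :
    sourceKernel d μ = μ.fst := by
  rw [sourceKernel, Kernel.fst_apply, transportKernel_apply_of_mem (mem_fstBallFinite μ)]
  rfl

/-- The kernel is either the true marginal or zero, so atoms it detects are genuine for every `μ`.
The events used in the conditional laws can therefore be described on the whole space of measures.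
-/
theorem fst_ne_zero_of_sourceKernel_ne_zero {μ : Measure (Space d × Space d)} {A : Set (Space d)}
    (h : sourceKernel d μ A ≠ 0) : μ.fst A ≠ 0 := by
  by_cases hμ : μ ∈ fstBallFinite d
  · rwa [sourceKernel, Kernel.fst_apply, transportKernel_apply_of_mem hμ] at h
  · simp [sourceKernel, Kernel.fst_apply, transportKernel_apply_of_notMem hμ] at h

end CanonicalKernel

/-! ### Comparison of first and second moments. -/

section Moments

variable {d : ℕ} {Ω : Type*} [MeasurableSpace Ω] {P : Measure Ω}
  {T : Ω → Measure (Space d × Space d)} {K L : Kernel (Ω × Space d) (Space d)}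
  [IsMarkovKernel K] [IsMarkovKernel L]
  {F : Kernel (ProbabilityMeasure (Space d)) (ProbabilityMeasure (Space d))}

theorem IsRandomTransport.sourceKernel_eq (hT : IsRandomTransport T) (ω : Ω) :
    sourceKernel d (T ω) = source T ω := by
  have := hT.locallyFinite ω
  exact sourceKernel_apply (T ω)

/-- The random points of `atomSeq` as functions of the transport. -/
def atomPoint (k : ℕ) (t : Measure (Space d × Space d)) : Space d := atomSeq (sourceKernel d t) k

/-- The weights of the points of `atomSeq` as functions of the transport. -/
def atomMass (k : ℕ) (t : Measure (Space d × Space d)) : ℝ≥0∞ := atomWeight (sourceKernel d t) k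

theorem measurable_atomPoint (k : ℕ) : Measurable (atomPoint (d := d) k) :=
  measurable_atomSeq _ k

theorem measurable_atomMass (k : ℕ) : Measurable (atomMass (d := d) k) :=
  measurable_atomWeight _ k

theorem IsRandomTransport.lintegral_source (hT : IsRandomTransport T) {ω : Ω}
    (hω : IsPurelyDiscrete (source T ω)) (f : Space d → ℝ≥0∞) :
    ∫⁻ x, f x ∂(source T ω) = ∑' k, atomMass k (T ω) * f (atomPoint k (T ω)) := by
  have : IsLocallyFiniteMeasure (source T ω) := hT.locallyFinite ω
  rw [lintegral_eq_tsum_atoms (source T ω) (fun x => isCompact_singleton.measure_ne_top) hω f]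
  simp only [atomMass, atomPoint, hT.sourceKernel_eq]

theorem destination_apply (K : Kernel (Ω × Space d) (Space d)) (Φ : Ω → Measure (Space d)) (ω : Ω)
    {B : Set (Space d)} (hB : MeasurableSet B) :
    destination K Φ ω B = ∫⁻ x, K (ω, x) B ∂(Φ ω) :=
  Measure.bind_apply hB (K.measurable.comp measurable_prodMk_left).aemeasurable

theorem IsRandomTransport.destination_eq_tsum (hT : IsRandomTransport T)
    (K : Kernel (Ω × Space d) (Space d)) {ω : Ω} (hω : IsPurelyDiscrete (source T ω)) {B : Set (Space d)} (hB : MeasurableSet B) :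
    destination K (source T) ω B =
      ∑' k, atomMass k (T ω) * K (ω, atomPoint k (T ω)) B := by
  rw [destination_apply K _ ω hB, hT.lintegral_source hω]

theorem measurable_kernel_atomPoint (hT : Measurable T) (K : Kernel (Ω × Space d) (Space d))
    {B : Set (Space d)} (hB : MeasurableSet B) (k : ℕ) :
    Measurable fun ω => K (ω, atomPoint k (T ω)) B :=
  (K.measurable_coe hB).comp (measurable_id.prodMk ((measurable_atomPoint k).comp hT))

theorem measurable_atomMass_mul_kernel_pair (hT : Measurable T) (K : Kernel (Ω × Space d) (Space d))
    {B C : Set (Space d)} (hB : MeasurableSet B) (hC : MeasurableSet C) (j k : ℕ) :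
    Measurable fun ω => atomMass j (T ω) * atomMass k (T ω) *
      (K (ω, atomPoint j (T ω)) B * K (ω, atomPoint k (T ω)) C) :=
  (((measurable_atomMass j).comp hT).mul ((measurable_atomMass k).comp hT)).mul
    ((measurable_kernel_atomPoint hT K hB j).mul (measurable_kernel_atomPoint hT K hC k))

theorem IsRandomTransport.lintegral_destination (hT : IsRandomTransport T)
    (hdisc : ∀ᵐ ω ∂P, IsPurelyDiscrete (source T ω)) (K : Kernel (Ω × Space d) (Space d))
    {B : Set (Space d)} (hB : MeasurableSet B) :
    ∫⁻ ω, destination K (source T) ω B ∂P =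
      ∑' k, ∫⁻ ω, atomMass k (T ω) * K (ω, atomPoint k (T ω)) B ∂P := by
  have hm : ∀ k, Measurable fun ω => atomMass k (T ω) * K (ω, atomPoint k (T ω)) B := fun k =>
    ((measurable_atomMass k).comp hT.measurable).mul
      (measurable_kernel_atomPoint hT.measurable K hB k)
  rw [← lintegral_tsum fun k => (hm k).aemeasurable]
  refine lintegral_congr_ae ?_
  filter_upwards [hdisc] with ω hω
  exact hT.destination_eq_tsum K hω hB

theorem IsRandomTransport.lintegral_destination_sq (hT : IsRandomTransport T)
    (hdisc : ∀ᵐ ω ∂P, IsPurelyDiscrete (source T ω)) (K : Kernel (Ω × Space d) (Space d))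
    {B : Set (Space d)} (hB : MeasurableSet B) :
    ∫⁻ ω, destination K (source T) ω B ^ 2 ∂P =
      ∑' j, ∑' k, ∫⁻ ω, atomMass j (T ω) * atomMass k (T ω) *
        (K (ω, atomPoint j (T ω)) B * K (ω, atomPoint k (T ω)) B) ∂P := by
  have hm := fun j k => measurable_atomMass_mul_kernel_pair hT.measurable K hB hB j k
  simp_rw [← lintegral_tsum fun k => (hm _ k).aemeasurable]
  rw [← lintegral_tsum fun j => (Measurable.tsum fun k => hm j k).aemeasurable]
  refine lintegral_congr_ae ?_
  filter_upwards [hdisc] with ω hω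
  rw [hT.destination_eq_tsum K hω hB, sq, ← ENNReal.tsum_mul_right]
  refine tsum_congr fun j => ?_
  rw [← ENNReal.tsum_mul_left]
  refine tsum_congr fun k => ?_
  ring

theorem two_mul_le_sq_add_sq (a b : ℝ≥0∞) : 2 * (a * b) ≤ a ^ 2 + b ^ 2 := by
  wlog h : a ≤ b generalizing a b
  · rw [mul_comm a b, add_comm]
    exact this b a (le_of_not_ge h)
  obtain ⟨c, rfl⟩ := exists_add_of_le h
  calc 2 * (a * (a + c)) ≤ 2 * (a * (a + c)) + c ^ 2 := le_self_add
    _ = a ^ 2 + (a + c) ^ 2 := by ring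

theorem measurable_probabilityMeasure_coe {B : Set (Space d)} (hB : MeasurableSet B) :
    Measurable fun π : ProbabilityMeasure (Space d) => (π : Measure (Space d)) B :=
  (Measure.measurable_coe hB).comp measurable_subtype_coe

/-- Jensen without subtraction: integrate `2 m π'(B) ≤ m² + π'(B)²` with `m = π(B)`; the left side
becomes `2 m²`, and the finite `m²` cancels. -/
theorem MeanValueProperty.sq_le_lintegral_sq [IsMarkovKernel F] (hF1 : MeanValueProperty F)
    (π : ProbabilityMeasure (Space d)) {B : Set (Space d)} (hB : MeasurableSet B) :
    (π : Measure (Space d)) B ^ 2 ≤ ∫⁻ π', (π' : Measure (Space d)) B ^ 2 ∂(F π) := by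
  have hm := measurable_probabilityMeasure_coe hB
  set m := (π : Measure (Space d)) B
  have h1 : ∫⁻ π', 2 * (m * (π' : Measure (Space d)) B) ∂(F π) ≤
      ∫⁻ π', (m ^ 2 + (π' : Measure (Space d)) B ^ 2) ∂(F π) :=
    lintegral_mono fun π' => two_mul_le_sq_add_sq _ _
  rw [lintegral_const_mul _ (hm.const_mul m), lintegral_const_mul _ hm, hF1 π B hB,
    lintegral_add_left measurable_const, lintegral_const, measure_univ, mul_one, two_mul,
    ← sq] at h1
  exact (ENNReal.add_le_add_iff_left (by finiteness)).1 h1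

theorem MeanValueProperty.lintegral_sq_le (hF1 : MeanValueProperty F)
    (π : ProbabilityMeasure (Space d)) {B : Set (Space d)} (hB : MeasurableSet B) :
    ∫⁻ π', (π' : Measure (Space d)) B ^ 2 ∂(F π) ≤
      (π : Measure (Space d)) B ^ 2 +
        (π : Measure (Space d)) B * (π : Measure (Space d)) Bᶜ := by
  calc ∫⁻ π', (π' : Measure (Space d)) B ^ 2 ∂(F π)
      ≤ ∫⁻ π', (π' : Measure (Space d)) B ∂(F π) :=
        lintegral_mono fun π' => pow_le_of_le_one zero_le prob_le_one two_ne_zero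
    _ = (π : Measure (Space d)) B * 1 := by rw [hF1 π B hB, mul_one]
    _ = _ := by
      rw [← measure_univ (μ := (π : Measure (Space d))), ← measure_add_measure_compl hB]
      ring

theorem fst_singleton_atomPoint_ne_zero {k : ℕ} {t : Measure (Space d × Space d)}
    (h : IsNewAtom (sourceKernel d t) k) : t.fst {atomPoint k t} ≠ 0 :=
  fst_ne_zero_of_sourceKernel_ne_zero h.1

/-- The expected first moments of both destinations agree. -/
theorem lintegral_destination_eq [IsProbabilityMeasure P] [IsMarkovKernel F]
    (hT : IsRandomTransport T)
    (hdisc : ∀ᵐ ω ∂P, IsPurelyDiscrete (source T ω)) (hF1 : MeanValueProperty F)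
    (hlaw : HasCondLawGiven P T K L F) {B : Set (Space d)} (hB : MeasurableSet B) :
    ∫⁻ ω, destination K (source T) ω B ∂P = ∫⁻ ω, destination L (source T) ω B ∂P := by
  rw [hT.lintegral_destination hdisc K hB, hT.lintegral_destination hdisc L hB]
  refine tsum_congr fun k => ?_
  refine (lintegral_kernelAt hT.measurable hlaw (measurable_atomPoint k)
    (measurableSet_isNewAtom (sourceKernel d) k) (fun t ht => fst_singleton_atomPoint_ne_zero ht)
    (measurable_atomMass k) (fun t ht => isNewAtom_of_atomWeight_ne_zero ht)
    (measurable_probabilityMeasure_coe hB)).trans ?_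
  refine lintegral_congr fun ω => ?_
  rw [hF1 _ B hB]
  rfl

/-- Given `T`, distinct atoms carry independent kernels, so the mean of the product factors and (F1)
evaluates each factor. Nonzero weights force both points to be new, hence distinct. -/
theorem lintegral_offDiag_eq [IsProbabilityMeasure P] [IsMarkovKernel F]
    (hT : IsRandomTransport T) (hF1 : MeanValueProperty F)
    (hindep : CondIndepGiven P T K) (hlaw : HasCondLawGiven P T K L F) {B : Set (Space d)}
    (hB : MeasurableSet B) {j k : ℕ} (hjk : j ≠ k) :
    ∫⁻ ω, atomMass j (T ω) * atomMass k (T ω) *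
        (K (ω, atomPoint j (T ω)) B * K (ω, atomPoint k (T ω)) B) ∂P =
      ∫⁻ ω, atomMass j (T ω) * atomMass k (T ω) *
        (L (ω, atomPoint j (T ω)) B * L (ω, atomPoint k (T ω)) B) ∂P := by
  refine (lintegral_kernelAt_pair hT.measurable hlaw hindep (measurable_atomPoint j)
    (measurable_atomPoint k) ((measurableSet_isNewAtom (sourceKernel d) j).inter
    (measurableSet_isNewAtom (sourceKernel d) k)) (fun t ht => fst_singleton_atomPoint_ne_zero ht.1)
    (fun t ht => fst_singleton_atomPoint_ne_zero ht.2) (fun t ht => ht.1.ne ht.2 hjk)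
    ((measurable_atomMass j).mul (measurable_atomMass k)) (fun t ht => ?_)
    (measurable_probabilityMeasure_coe hB) (measurable_probabilityMeasure_coe hB)).trans ?_
  · exact ⟨isNewAtom_of_atomWeight_ne_zero (left_ne_zero_of_mul ht),
      isNewAtom_of_atomWeight_ne_zero (right_ne_zero_of_mul ht)⟩
  · refine lintegral_congr fun ω => ?_
    rw [hF1 _ B hB, hF1 _ B hB]
    rfl

theorem lintegral_diag_eq [IsProbabilityMeasure P] [IsMarkovKernel F]
    (hT : IsRandomTransport T) (hlaw : HasCondLawGiven P T K L F)
    {B : Set (Space d)} (hB : MeasurableSet B) (k : ℕ) :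
    ∫⁻ ω, atomMass k (T ω) * atomMass k (T ω) *
        (K (ω, atomPoint k (T ω)) B * K (ω, atomPoint k (T ω)) B) ∂P =
      ∫⁻ ω, atomMass k (T ω) * atomMass k (T ω) *
        ∫⁻ π, (π : Measure (Space d)) B ^ 2 ∂(F (kernelAt L ω (atomPoint k (T ω)))) ∂P := by
  refine Eq.trans (lintegral_congr fun ω => ?_)
    (lintegral_kernelAt hT.measurable hlaw (measurable_atomPoint k)
    (measurableSet_isNewAtom (sourceKernel d) k) (fun t ht => fst_singleton_atomPoint_ne_zero ht)
    ((measurable_atomMass k).mul (measurable_atomMass k))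
    (fun t ht => isNewAtom_of_atomWeight_ne_zero (left_ne_zero_of_mul ht))
    ((measurable_probabilityMeasure_coe hB).pow_const 2))
  rw [← sq (K (ω, atomPoint k (T ω)) B)]
  rfl

/-- A bound for the mean conditional variance of `KΦ(B)`. -/
def varianceExcess (P : Measure Ω) (T : Ω → Measure (Space d × Space d))
    (L : Kernel (Ω × Space d) (Space d)) (B : Set (Space d)) : ℝ≥0∞ :=
  ∫⁻ ω, ∫⁻ x, source T ω {x} * (L (ω, x) B * L (ω, x) Bᶜ) ∂(source T ω) ∂P

theorem varianceExcess_eq_tsum (hT : IsRandomTransport T)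
    (hdisc : ∀ᵐ ω ∂P, IsPurelyDiscrete (source T ω)) (L : Kernel (Ω × Space d) (Space d)) {B : Set (Space d)} (hB : MeasurableSet B) :
    varianceExcess P T L B = ∑' k, ∫⁻ ω, atomMass k (T ω) * atomMass k (T ω) *
      (L (ω, atomPoint k (T ω)) B * L (ω, atomPoint k (T ω)) Bᶜ) ∂P := by
  rw [← lintegral_tsum fun k =>
    (measurable_atomMass_mul_kernel_pair hT.measurable L hB hB.compl k k).aemeasurable]
  refine lintegral_congr_ae ?_
  filter_upwards [hdisc] with ω hω
  rw [hT.lintegral_source hω]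
  refine tsum_congr fun k => ?_
  by_cases h : IsNewAtom (sourceKernel d (T ω)) k
  · have h1 : atomMass k (T ω) = source T ω {atomPoint k (T ω)} := by
      rw [atomMass, atomWeight, if_pos h, ← hT.sourceKernel_eq]
      rfl
    rw [← h1, mul_assoc]
  · have h1 : atomMass k (T ω) = 0 := if_neg h
    simp [h1]

theorem lintegral_destination_sq_le [IsProbabilityMeasure P] [IsMarkovKernel F]
    (hT : IsRandomTransport T)
    (hdisc : ∀ᵐ ω ∂P, IsPurelyDiscrete (source T ω)) (hF1 : MeanValueProperty F)
    (hindep : CondIndepGiven P T K) (hlaw : HasCondLawGiven P T K L F) {B : Set (Space d)}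
    (hB : MeasurableSet B) :
    ∫⁻ ω, destination L (source T) ω B ^ 2 ∂P ≤ ∫⁻ ω, destination K (source T) ω B ^ 2 ∂P := by
  rw [hT.lintegral_destination_sq hdisc K hB, hT.lintegral_destination_sq hdisc L hB]
  refine ENNReal.tsum_le_tsum fun j => ENNReal.tsum_le_tsum fun k => ?_
  rcases eq_or_ne j k with rfl | hjk
  · rw [lintegral_diag_eq hT hlaw hB]
    refine lintegral_mono fun ω => ?_
    rw [← sq (L (ω, atomPoint j (T ω)) B)]
    exact mul_le_mul_right (hF1.sq_le_lintegral_sq (kernelAt L ω (atomPoint j (T ω))) hB) _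
  · rw [lintegral_offDiag_eq hT hF1 hindep hlaw hB hjk]

theorem lintegral_destination_sq_le_add [IsProbabilityMeasure P] [IsMarkovKernel F]
    (hT : IsRandomTransport T)
    (hdisc : ∀ᵐ ω ∂P, IsPurelyDiscrete (source T ω)) (hF1 : MeanValueProperty F)
    (hindep : CondIndepGiven P T K) (hlaw : HasCondLawGiven P T K L F) {B : Set (Space d)}
    (hB : MeasurableSet B) :
    ∫⁻ ω, destination K (source T) ω B ^ 2 ∂P ≤
      ∫⁻ ω, destination L (source T) ω B ^ 2 ∂P + varianceExcess P T L B := by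
  classical
  rw [hT.lintegral_destination_sq hdisc K hB, hT.lintegral_destination_sq hdisc L hB,
    varianceExcess_eq_tsum hT hdisc L hB, ← ENNReal.tsum_add]
  refine ENNReal.tsum_le_tsum fun j => ?_
  -- The single sum for the excess is written as a double sum supported on the diagonal, so that the
  -- comparison can be made term by term.
  rw [← tsum_ite_eq j fun k => ∫⁻ ω, atomMass k (T ω) * atomMass k (T ω) *
      (L (ω, atomPoint k (T ω)) B * L (ω, atomPoint k (T ω)) Bᶜ) ∂P, ← ENNReal.tsum_add]
  refine ENNReal.tsum_le_tsum fun k => ?_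
  rcases eq_or_ne k j with rfl | hjk
  · rw [if_pos rfl, lintegral_diag_eq hT hlaw hB, ← lintegral_add_left]
    · refine lintegral_mono fun ω => ?_
      rw [← mul_add, ← sq (L (ω, atomPoint k (T ω)) B)]
      exact mul_le_mul_right (hF1.lintegral_sq_le (kernelAt L ω (atomPoint k (T ω))) hB) _
    · exact measurable_atomMass_mul_kernel_pair hT.measurable L hB hB k k
  · rw [if_neg hjk, add_zero, lintegral_offDiag_eq hT hF1 hindep hlaw hB hjk.symm]

end Moments


/-! ### Mass transport for shift invariant measures. -/

section MassTransport

variable {d : ℕ}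

theorem unitCube_eq_preimage (d : ℕ) :
    unitCube d = WithLp.ofLp ⁻¹' (Set.univ.pi fun _ : Fin d => Set.Icc (0 : ℝ) 1) := by
  ext x
  simp only [unitCube, Set.mem_ofPred_eq, Set.mem_preimage, Set.mem_univ_pi]

theorem measurableSet_unitCube (d : ℕ) : MeasurableSet (unitCube d) := by
  rw [unitCube_eq_preimage]
  exact (PiLp.volume_preserving_ofLp (Fin d)).measurable
    (MeasurableSet.univ_pi fun _ => measurableSet_Icc)

theorem volume_unitCube (d : ℕ) : volume (unitCube d) = 1 := by
  rw [unitCube_eq_preimage, (PiLp.volume_preserving_ofLp (Fin d)).measure_preimage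
    (MeasurableSet.univ_pi fun _ => measurableSet_Icc).nullMeasurableSet, volume_pi_pi]
  simp

/-- The mass transport principle: integration with respect to a shift invariant measure
reduces to the part of the measure over the unit cube. -/
theorem lintegral_eq_of_shift_invariant {E : Type*} [MeasurableSpace E] (N : Measure E)
    [SFinite N] (sh : Space d → E → E) (hsh : Measurable (Function.uncurry sh))
    (hinv : ∀ s, N.map (sh s) = N) (hcancel : ∀ s e, sh (-s) (sh s e) = e) (π : E → Space d)
    (hπ : Measurable π) (hπsh : ∀ s e, π (sh s e) = π e - s) {f : E → ℝ≥0∞} (hf : Measurable f) :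
    ∫⁻ e, f e ∂N = ∫⁻ e in π ⁻¹' unitCube d, ∫⁻ s, f (sh (-s) e) ∂volume ∂N := by
  classical
  have hQ := measurableSet_unitCube d
  let q : Space d → ℝ≥0∞ := (unitCube d).indicator 1
  have hq : Measurable q := measurable_one.indicator hQ
  have h1 : ∀ c : Space d, ∫⁻ s, q (c - s) = 1 := by
    intro c
    rw [(Measure.measurePreserving_sub_left volume c).lintegral_comp hq, lintegral_indicator_one hQ,
      volume_unitCube]
  have hshs : ∀ s, Measurable (sh s) := fun s => hsh.comp measurable_prodMk_left
  have hm1 : Measurable fun p : E × Space d => f p.1 * q (π p.1 - p.2) := by fun_prop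
  have hshn : Measurable fun p : E × Space d => sh (-p.2) p.1 :=
    hsh.comp (measurable_snd.neg.prodMk measurable_fst)
  have hm2 : Measurable fun p : E × Space d => f (sh (-p.2) p.1) * q (π p.1) := by fun_prop
  -- Insert `∫ q(π e - s) ds = 1`, exchange the integrals, and use invariance for each fixed `s` to
  -- move the shift from `q` to `f`.
  calc ∫⁻ e, f e ∂N = ∫⁻ e, ∫⁻ s, f e * q (π e - s) ∂volume ∂N := by
        refine lintegral_congr fun e => ?_
        rw [lintegral_const_mul _ (by fun_prop), h1, mul_one]
    _ = ∫⁻ s, ∫⁻ e, f e * q (π e - s) ∂N := lintegral_lintegral_swap hm1.aemeasurable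
    _ = ∫⁻ s, ∫⁻ e, f (sh (-s) e) * q (π e) ∂N := by
        refine lintegral_congr fun s => ?_
        have hm3 : Measurable fun e => f (sh (-s) e) * q (π e) :=
          hm2.comp measurable_prodMk_right
        conv_rhs => rw [← hinv s]
        rw [lintegral_map hm3 (hshs s)]
        simp_rw [hcancel, hπsh]
    _ = ∫⁻ e, ∫⁻ s, f (sh (-s) e) * q (π e) ∂volume ∂N :=
        (lintegral_lintegral_swap hm2.aemeasurable).symm
    _ = _ := by
        rw [← lintegral_indicator (hπ hQ)]
        refine lintegral_congr fun e => ?_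
        by_cases he : π e ∈ unitCube d
        · rw [Set.indicator_of_mem (show e ∈ π ⁻¹' unitCube d from he)]
          simp [q, he]
        · rw [Set.indicator_of_notMem (show e ∉ π ⁻¹' unitCube d from he)]
          simp [q, he]

theorem measure_eq_of_shift_invariant {E : Type*} [MeasurableSpace E] (N : Measure E)
    [SFinite N] (sh : Space d → E → E) (hsh : Measurable (Function.uncurry sh))
    (hinv : ∀ s, N.map (sh s) = N) (hcancel : ∀ s e, sh (-s) (sh s e) = e) (π : E → Space d)
    (hπ : Measurable π) (hπsh : ∀ s e, π (sh s e) = π e - s) {G : Set E} (hG : MeasurableSet G) :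
    N G = ∫⁻ e in π ⁻¹' unitCube d, volume {s | sh (-s) e ∈ G} ∂N := by
  rw [← lintegral_indicator_one hG, lintegral_eq_of_shift_invariant N sh hsh hinv hcancel π hπ
    hπsh (measurable_one.indicator hG)]
  refine lintegral_congr fun e => ?_
  have hm : Measurable fun s : Space d => sh (-s) e :=
    hsh.comp (measurable_neg.prodMk measurable_const)
  exact lintegral_indicator_one (hm hG)

end MassTransport

/-! ### Invariant mean measures of a stationary transport. -/

section Invariance

variable {d : ℕ} {Ω : Type*} [MeasurableSpace Ω] {P : Measure Ω}
  {T : Ω → Measure (Space d × Space d)}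

/-- The diagonal shift of a pair of points. -/
def shiftPair (s : Space d) (p : Space d × Space d) : Space d × Space d := (p.1 - s, p.2 - s)

theorem measurable_shiftPair : Measurable (Function.uncurry (shiftPair (d := d))) := by
  unfold Function.uncurry shiftPair
  fun_prop

theorem measurable_shiftPair_right (s : Space d) : Measurable (shiftPair s) :=
  measurable_shiftPair.comp measurable_prodMk_left

/-- The diagonal shift of a quadruple of points. -/
def shiftQuad (s : Space d) (e : (Space d × Space d) × (Space d × Space d)) :
    (Space d × Space d) × (Space d × Space d) := (shiftPair s e.1, shiftPair s e.2)

theorem measurable_shiftQuad : Measurable (Function.uncurry (shiftQuad (d := d))) :=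
  (measurable_shiftPair.comp (measurable_fst.prodMk (measurable_fst.comp measurable_snd))).prodMk
    (measurable_shiftPair.comp (measurable_fst.prodMk (measurable_snd.comp measurable_snd)))

theorem diagShift_mem_fstBallFinite {μ : Measure (Space d × Space d)}
    (h : μ ∈ fstBallFinite d) (s : Space d) : diagShift s μ ∈ fstBallFinite d := by
  intro n
  obtain ⟨m, hm⟩ := exists_nat_ge (n + ‖s‖)
  have h1 : diagShift s μ (Metric.closedBall 0 (n : ℝ) ×ˢ Set.univ) =
      μ (shiftPair s ⁻¹' (Metric.closedBall 0 (n : ℝ) ×ˢ Set.univ)) :=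
    Measure.map_apply (measurable_shiftPair_right s) (measurableSet_closedBall_prod_univ d n)
  rw [h1]
  refine (measure_mono ?_).trans_lt (h m)
  rintro ⟨x, y⟩ hx
  have hx' : ‖x - s‖ ≤ n := by simpa [shiftPair] using hx
  have : ‖x‖ ≤ m := by
    calc ‖x‖ = ‖(x - s) + s‖ := by rw [sub_add_cancel]
      _ ≤ ‖x - s‖ + ‖s‖ := norm_add_le _ _
      _ ≤ m := by linarith
  simpa using this

theorem transportKernel_diagShift {μ : Measure (Space d × Space d)}
    (h : μ ∈ fstBallFinite d) (s : Space d) :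
    transportKernel d (diagShift s μ) = (transportKernel d μ).map (shiftPair s) := by
  rw [transportKernel_apply_of_mem h,
    transportKernel_apply_of_mem (diagShift_mem_fstBallFinite h s)]
  rfl

theorem IsRandomTransport.mem_fstBallFinite (hT : IsRandomTransport T) (ω : Ω) :
    T ω ∈ fstBallFinite d := by
  have := hT.locallyFinite ω
  exact Transport.mem_fstBallFinite (T ω)

theorem measurable_diagShift (s : Space d) : Measurable (diagShift (d := d) s) :=
  Measure.measurable_map _ (measurable_shiftPair_right s)

/-- Equivariant kernels turn a stationary transport into an invariant mean measure. -/
theorem map_bind_eq_of_isStationary (hT : IsRandomTransport T) (hstat : IsStationary P T)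
    {E : Type*} [MeasurableSpace E] (κ : Kernel (Measure (Space d × Space d)) E) (s : Space d)
    {g : E → E} (hg : Measurable g)
    (hκ : ∀ μ ∈ fstBallFinite d, κ (diagShift s μ) = (κ μ).map g) :
    (κ ∘ₘ (P.map T)).map g = κ ∘ₘ (P.map T) := by
  ext A hA
  rw [Measure.map_apply hg hA, Measure.bind_apply (hg hA) κ.aemeasurable,
    Measure.bind_apply hA κ.aemeasurable]
  conv_rhs => rw [← hstat s]
  rw [lintegral_map (κ.measurable_coe (hg hA)) hT.measurable,
    lintegral_map (κ.measurable_coe hA)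
      (show Measurable fun ω => diagShift s (T ω) from (measurable_diagShift s).comp hT.measurable)]
  refine lintegral_congr fun ω => ?_
  rw [hκ _ (hT.mem_fstBallFinite ω), Measure.map_apply hg hA]

/-- The mean measure of the transport. -/
def meanMeasure (P : Measure Ω) (T : Ω → Measure (Space d × Space d)) :
    Measure (Space d × Space d) := transportKernel d ∘ₘ (P.map T)

/-- The second moment measure of the transport, restricted to pairs with common source. -/
def commonSourceMeasure (P : Measure Ω) (T : Ω → Measure (Space d × Space d)) :
    Measure ((Space d × Space d) × (Space d × Space d)) :=
  (((transportKernel d) ×ₖ (transportKernel d)) ∘ₘ (P.map T)).restrict {e | e.1.1 = e.2.1}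

instance [SFinite P] : SFinite (meanMeasure P T) :=
  inferInstanceAs (SFinite (transportKernel d ∘ₘ (P.map T)))

instance [SFinite P] : SFinite (commonSourceMeasure P T) :=
  inferInstanceAs (SFinite (Measure.restrict _ _))

theorem map_meanMeasure (hT : IsRandomTransport T) (hstat : IsStationary P T) (s : Space d) :
    (meanMeasure P T).map (shiftPair s) = meanMeasure P T :=
  map_bind_eq_of_isStationary hT hstat _ s (measurable_shiftPair_right s)
    fun _ h => transportKernel_diagShift h s

theorem measurableSet_commonSource :
    MeasurableSet {e : (Space d × Space d) × (Space d × Space d) | e.1.1 = e.2.1} :=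
  measurableSet_eq_fun (by fun_prop) (by fun_prop)

theorem map_commonSourceMeasure (hT : IsRandomTransport T) (hstat : IsStationary P T)
    (s : Space d) :
    (commonSourceMeasure P T).map (shiftQuad s) = commonSourceMeasure P T := by
  have hm : Measurable (shiftQuad s) := measurable_shiftQuad.comp measurable_prodMk_left
  have hpre : {e : (Space d × Space d) × (Space d × Space d) | e.1.1 = e.2.1} =
      shiftQuad s ⁻¹' {e | e.1.1 = e.2.1} := by
    ext e
    simp [shiftQuad, shiftPair]
  unfold commonSourceMeasure
  conv_lhs => rw [hpre]
  rw [← Measure.restrict_map hm measurableSet_commonSource,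
    map_bind_eq_of_isStationary hT hstat _ s hm]
  intro μ hμ
  rw [Kernel.prod_apply, Kernel.prod_apply, transportKernel_diagShift hμ,
    Measure.map_prod_map _ _ (measurable_shiftPair_right s) (measurable_shiftPair_right s)]
  rfl

end Invariance

/-! ### Excess variance via mass transport, and its asymptotics. -/

section Evaluation

variable {d : ℕ} {Ω : Type*} [MeasurableSpace Ω] {P : Measure Ω}
  {T : Ω → Measure (Space d × Space d)} {L : Kernel (Ω × Space d) (Space d)} [IsMarkovKernel L]

theorem IsRandomTransport.sFinite_source (hT : IsRandomTransport T) (ω : Ω) :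
    SFinite (source T ω) := by
  rw [← hT.sourceKernel_eq]
  infer_instance

theorem IsRandomTransport.transportKernel_apply (hT : IsRandomTransport T) (ω : Ω) :
    transportKernel d (T ω) = T ω :=
  transportKernel_apply_of_mem (hT.mem_fstBallFinite ω)

theorem IsRandomTransport.sFinite (hT : IsRandomTransport T) (ω : Ω) : SFinite (T ω) := by
  rw [← hT.transportKernel_apply]
  infer_instance

theorem apply_prod_of_disintegration (hT : IsRandomTransport T) {ω : Ω}
    (hω : T ω = (source T ω) ⊗ₘ (L.sectR ω)) {A B : Set (Space d)} (hA : MeasurableSet A)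
    (hB : MeasurableSet B) : T ω (A ×ˢ B) = ∫⁻ x in A, L (ω, x) B ∂(source T ω) := by
  have := hT.sFinite_source ω
  rw [hω, Measure.compProd_apply_prod hA hB]
  rfl

theorem meanMeasure_univ_prod (hT : IsRandomTransport T) (hL : Disintegrates P T L)
    {B : Set (Space d)} (hB : MeasurableSet B) :
    meanMeasure P T (Set.univ ×ˢ B) = ∫⁻ ω, destination L (source T) ω B ∂P := by
  have hm := (MeasurableSet.univ : MeasurableSet (Set.univ : Set (Space d))).prod hB
  rw [meanMeasure, Measure.bind_apply hm (transportKernel d).aemeasurable,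
    lintegral_map ((transportKernel d).measurable_coe hm) hT.measurable]
  refine lintegral_congr_ae ?_
  filter_upwards [hL] with ω hω
  rw [hT.transportKernel_apply, apply_prod_of_disintegration hT hω MeasurableSet.univ hB,
    destination_apply L _ ω hB, Measure.restrict_univ]

theorem commonSourceMeasure_apply (hT : IsRandomTransport T) (hL : Disintegrates P T L)
    {A B C : Set (Space d)} (hA : MeasurableSet A) (hB : MeasurableSet B) (hC : MeasurableSet C) :
    commonSourceMeasure P T {e | e.1.1 ∈ A ∧ e.1.2 ∈ B ∧ e.2.2 ∈ C} =
      ∫⁻ ω, ∫⁻ x in A, source T ω {x} * (L (ω, x) B * L (ω, x) C) ∂(source T ω) ∂P := by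
  classical
  have hm : MeasurableSet {e : (Space d × Space d) × (Space d × Space d) |
      e.1.1 ∈ A ∧ e.1.2 ∈ B ∧ e.2.2 ∈ C} :=
    (hA.preimage (by fun_prop : Measurable fun e : (Space d × Space d) × (Space d × Space d) =>
      e.1.1)).inter ((hB.preimage (by fun_prop : Measurable
      fun e : (Space d × Space d) × (Space d × Space d) => e.1.2)).inter
      (hC.preimage (by fun_prop : Measurable
      fun e : (Space d × Space d) × (Space d × Space d) => e.2.2)))
  have hm' := hm.inter (measurableSet_commonSource (d := d))
  rw [commonSourceMeasure, Measure.restrict_apply hm,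
    Measure.bind_apply hm' (Kernel.aemeasurable _),
    lintegral_map (Kernel.measurable_coe _ hm') hT.measurable]
  refine lintegral_congr_ae ?_
  filter_upwards [hL] with ω hω
  have h1 := hT.sFinite ω
  have h2 := hT.sFinite_source ω
  have hsect : ∀ x, T ω ({x} ×ˢ C) = source T ω {x} * L (ω, x) C := fun x => by
    rw [apply_prod_of_disintegration hT hω (measurableSet_singleton x) hC, lintegral_singleton,
      mul_comm]
  -- With the first pair fixed, the second must lie in `{p.1} ×ˢ C`; this is the origin of the
  -- factor `Φ{x}`.
  have hslice : ∀ p : Space d × Space d, T ω (Prod.mk p ⁻¹' ({e | e.1.1 ∈ A ∧ e.1.2 ∈ B ∧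
      e.2.2 ∈ C} ∩ {e | e.1.1 = e.2.1})) =
      A.indicator (fun x => source T ω {x} * L (ω, x) C) p.1 * B.indicator 1 p.2 := by
    intro p
    by_cases hpA : p.1 ∈ A
    · by_cases hpB : p.2 ∈ B
      · rw [Set.indicator_of_mem hpA, Set.indicator_of_mem hpB, ← hsect, Pi.one_apply, mul_one]
        congr 1
        ext q
        simp [hpA, hpB, and_comm, eq_comm]
      · simp [hpB]
    · simp [hpA]
  have hmass : Measurable fun x => source T ω {x} * L (ω, x) C := by
    have h3 : Measurable fun x => source T ω {x} := by
      rw [← hT.sourceKernel_eq]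
      exact (measurable_singleton_mass (sourceKernel d)).comp
        (measurable_const.prodMk measurable_id)
    exact h3.mul ((L.measurable_coe hC).comp measurable_prodMk_left)
  have hind : Measurable (A.indicator fun x => source T ω {x} * L (ω, x) C) :=
    hmass.indicator hA
  have hBi : Measurable (B.indicator (1 : Space d → ℝ≥0∞)) := measurable_one.indicator hB
  rw [Kernel.prod_apply, hT.transportKernel_apply, Measure.prod_apply hm']
  simp_rw [hslice]
  nth_rewrite 1 [hω]
  rw [Measure.lintegral_compProd (by fun_prop), ← lintegral_indicator hA]
  refine lintegral_congr fun x => ?_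
  beta_reduce
  dsimp only
  rw [lintegral_const_mul _ hBi, lintegral_indicator_one hB, Kernel.sectR_apply]
  by_cases hx : x ∈ A
  · rw [Set.indicator_of_mem hx, Set.indicator_of_mem hx]
    ring
  · simp [hx]

theorem varianceExcess_eq (hT : IsRandomTransport T) (hL : Disintegrates P T L)
    {B : Set (Space d)} (hB : MeasurableSet B) :
    varianceExcess P T L B = commonSourceMeasure P T {e | e.1.2 ∈ B ∧ e.2.2 ∈ Bᶜ} := by
  have h := commonSourceMeasure_apply hT hL MeasurableSet.univ hB hB.compl
  simp only [Set.mem_univ, true_and, Measure.restrict_univ] at h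
  exact h.symm

/-- The restriction of the common source measure to sources in the unit cube. -/
def palmPairMeasure (P : Measure Ω) (T : Ω → Measure (Space d × Space d)) :
    Measure ((Space d × Space d) × (Space d × Space d)) :=
  (commonSourceMeasure P T).restrict ((fun e => e.1.1) ⁻¹' unitCube d)

theorem isFiniteMeasure_palmPairMeasure (hT : IsRandomTransport T) (hL : Disintegrates P T L)
    (hint : intensity P (source T) < ∞)
    (hPalm : palmExpectation P (source T) (fun φ => φ {0}) < ∞) :
    IsFiniteMeasure (palmPairMeasure P T) := by
  have h := commonSourceMeasure_apply hT hL (measurableSet_unitCube d) MeasurableSet.univ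
    MeasurableSet.univ
  simp only [Set.mem_univ, and_true, measure_univ, mul_one] at h
  constructor
  rw [palmPairMeasure, Measure.restrict_apply_univ]
  refine lt_of_eq_of_lt h ?_
  have hshift : ∀ ω x, shift x (source T ω) {0} = source T ω {x} := fun ω x => by
    rw [shift, Measure.map_apply (by fun_prop) (measurableSet_singleton 0)]
    congr 1
    ext y
    simp [sub_eq_zero]
  simp only [palmExpectation, hshift] at hPalm
  -- Finite intensity makes `γ⁻¹` nonzero, so an infinite integral would make the Palm expectation
  -- infinite. This covers `γ = 0` too, where `γ⁻¹ = ∞`.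
  by_contra hinf
  rw [not_lt_top_iff.1 hinf, ENNReal.mul_top (ENNReal.inv_ne_zero.2 hint.ne)] at hPalm
  exact lt_irrefl _ hPalm

theorem varianceExcess_eq_lintegral [SFinite P] (hT : IsRandomTransport T)
    (hstat : IsStationary P T)
    (hL : Disintegrates P T L) {B : Set (Space d)} (hB : MeasurableSet B) :
    varianceExcess P T L B =
      ∫⁻ e, volume {s | e.1.2 + s ∈ B ∧ e.2.2 + s ∉ B} ∂(palmPairMeasure P T) := by
  have hG : MeasurableSet {e : (Space d × Space d) × (Space d × Space d) |
      e.1.2 ∈ B ∧ e.2.2 ∈ Bᶜ} :=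
    (hB.preimage (by fun_prop : Measurable
      fun e : (Space d × Space d) × (Space d × Space d) => e.1.2)).inter
      (hB.compl.preimage (by fun_prop : Measurable
      fun e : (Space d × Space d) × (Space d × Space d) => e.2.2))
  rw [varianceExcess_eq hT hL hB,
    measure_eq_of_shift_invariant (commonSourceMeasure P T) shiftQuad measurable_shiftQuad
      (map_commonSourceMeasure hT hstat) (fun s e => by simp [shiftQuad, shiftPair])
      (fun e => e.1.1) (by fun_prop) (fun s e => rfl) hG]
  refine lintegral_congr fun e => ?_
  congr 1
  ext s
  simp [shiftQuad, shiftPair]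

/-- Stationarity makes the mean measure of `LΦ` absolutely continuous: after mass transport the
inner integral is the volume of a translate of `B`. It is used for boundaries of windows. -/
theorem lintegral_destination_eq_zero [SFinite P] (hT : IsRandomTransport T)
    (hstat : IsStationary P T)
    (hL : Disintegrates P T L) {B : Set (Space d)} (hB : MeasurableSet B) (hB0 : volume B = 0) :
    ∫⁻ ω, destination L (source T) ω B ∂P = 0 := by
  have hG := (MeasurableSet.univ : MeasurableSet (Set.univ : Set (Space d))).prod hB
  rw [← meanMeasure_univ_prod hT hL hB,
    measure_eq_of_shift_invariant (meanMeasure P T) shiftPair measurable_shiftPair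
      (map_meanMeasure hT hstat) (fun s e => by simp [shiftPair])
      (fun e => e.1) (by fun_prop) (fun s e => rfl) hG]
  refine (lintegral_congr fun e => ?_).trans lintegral_zero
  rw [← measure_preimage_add volume e.2 B] at hB0
  convert hB0 using 2
  ext s
  simp [shiftPair, add_comm]

theorem volume_setOf_add_mem_le (B : Set (Space d)) (y z : Space d) :
    volume {s | y + s ∈ B ∧ z + s ∉ B} ≤ volume B := by
  rw [← measure_preimage_add volume y B]
  exact measure_mono fun s hs => hs.1

theorem varianceExcess_lt_top [SFinite P] (hT : IsRandomTransport T)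
    (hstat : IsStationary P T)
    (hL : Disintegrates P T L) (hint : intensity P (source T) < ∞)
    (hPalm : palmExpectation P (source T) (fun φ => φ {0}) < ∞)
    {B : Set (Space d)} (hB : MeasurableSet B) (hB' : Bornology.IsBounded B) :
    varianceExcess P T L B < ∞ := by
  have := isFiniteMeasure_palmPairMeasure hT hL hint hPalm
  rw [varianceExcess_eq_lintegral hT hstat hL hB]
  calc ∫⁻ e, volume {s | e.1.2 + s ∈ B ∧ e.2.2 + s ∉ B} ∂(palmPairMeasure P T)
      ≤ ∫⁻ _, volume B ∂(palmPairMeasure P T) :=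
        lintegral_mono fun e => volume_setOf_add_mem_le B _ _
    _ < ∞ := by
      rw [lintegral_const]
      exact ENNReal.mul_lt_top hB'.measure_lt_top (measure_lt_top _ _)

/-- The relative volume of the part of a dilated open set which leaves the set under a fixed
translation vanishes asymptotically. -/
theorem tendsto_volume_leaving {U : Set (Space d)} (hU : IsOpen U) (hU' : Bornology.IsBounded U)
    (hne : U.Nonempty) (y z : Space d) :
    Tendsto (fun r : ℝ => (volume (r • U))⁻¹ * volume {s | y + s ∈ r • U ∧ z + s ∉ r • U})
      atTop (𝓝 0) := by
  have hU0 : volume U ≠ 0 := (hU.measure_pos volume hne).ne'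
  have hUtop : volume U ≠ ∞ := hU'.measure_lt_top.ne
  -- This is the numerator after the substitution `s = r u - y`, up to the scaling factor of the
  -- volume. As `U` is open, each `u ∈ U` eventually drops out.
  have hlim : Tendsto (fun r : ℝ => volume {u | u ∈ U ∧ u + r⁻¹ • (z - y) ∉ U}) atTop
      (𝓝 (volume (∅ : Set (Space d)))) := by
    refine tendsto_measure_of_tendsto_indicator atTop (fun r => ?_) hU.measurableSet hUtop
      (Eventually.of_forall fun r u hu => hu.1) fun u => ?_
    · exact hU.measurableSet.inter (hU.measurableSet.preimage
        (by fun_prop : Measurable fun u : Space d => u + r⁻¹ • (z - y))).compl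
    · by_cases hu : u ∈ U
      · have h1 : Tendsto (fun r : ℝ => u + r⁻¹ • (z - y)) atTop (𝓝 u) := by
          have := (tendsto_inv_atTop_zero (𝕜 := ℝ)).smul_const (z - y)
          simpa using this.const_add u
        filter_upwards [h1 (hU.mem_nhds hu)] with r hr
        simp only [Set.mem_empty_iff_false, iff_false, not_and, not_not]
        exact fun _ => hr
      · exact Eventually.of_forall fun r => by simp [hu]
  rw [measure_empty] at hlim
  have hlim' := ENNReal.Tendsto.const_mul (a := (volume U)⁻¹) hlim
    (Or.inr (ENNReal.inv_ne_top.2 hU0))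
  rw [mul_zero] at hlim'
  refine hlim'.congr' ?_
  filter_upwards [eventually_gt_atTop 0] with r hr
  have h1 : {s | y + s ∈ r • U ∧ z + s ∉ r • U} =
      (fun s => y + s) ⁻¹' (r • {u | u ∈ U ∧ u + r⁻¹ • (z - y) ∉ U}) := by
    ext s
    simp only [Set.mem_ofPred_eq, Set.mem_preimage, Set.mem_smul_set_iff_inv_smul_mem₀ hr.ne',
      ← smul_add]
    rw [show y + s + (z - y) = z + s by abel]
  rw [h1, measure_preimage_add, Measure.addHaar_smul, Measure.addHaar_smul]
  set c := ENNReal.ofReal |r ^ Module.finrank ℝ (Space d)|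
  have hc : c ≠ 0 := by
    simp only [c, ne_eq, ENNReal.ofReal_eq_zero, not_le]
    positivity
  have hc' : c ≠ ∞ := ENNReal.ofReal_ne_top
  rw [ENNReal.mul_inv (Or.inl hc) (Or.inl hc'), mul_mul_mul_comm, ENNReal.inv_mul_cancel hc hc',
    one_mul]

theorem tendsto_varianceExcess [SFinite P] (hT : IsRandomTransport T)
    (hstat : IsStationary P T)
    (hL : Disintegrates P T L) (hint : intensity P (source T) < ∞)
    (hPalm : palmExpectation P (source T) (fun φ => φ {0}) < ∞)
    {U : Set (Space d)} (hU : IsOpen U) (hU' : Bornology.IsBounded U) (hne : U.Nonempty) :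
    Tendsto (fun r : ℝ => (volume (r • U))⁻¹ * varianceExcess P T L (r • U)) atTop (𝓝 0) := by
  have := isFiniteMeasure_palmPairMeasure hT hL hint hPalm
  have hmeas : ∀ B : Set (Space d), MeasurableSet B →
      Measurable fun e : (Space d × Space d) × (Space d × Space d) =>
        volume {s | e.1.2 + s ∈ B ∧ e.2.2 + s ∉ B} := by
    intro B hB
    have hS : MeasurableSet {p : ((Space d × Space d) × (Space d × Space d)) × Space d |
        p.1.1.2 + p.2 ∈ B ∧ p.1.2.2 + p.2 ∉ B} :=
      (hB.preimage (by fun_prop : Measurable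
        fun p : ((Space d × Space d) × (Space d × Space d)) × Space d => p.1.1.2 + p.2)).inter
        (hB.preimage (by fun_prop : Measurable
        fun p : ((Space d × Space d) × (Space d × Space d)) × Space d => p.1.2.2 + p.2)).compl
    exact measurable_measure_prodMk_left hS
  have hopen : ∀ᶠ r : ℝ in atTop, MeasurableSet (r • U) := by
    filter_upwards [eventually_gt_atTop 0] with r hr
    exact (hU.smul₀ hr.ne').measurableSet
  have key := tendsto_lintegral_filter_of_dominated_convergence (μ := palmPairMeasure P T)
    (l := (atTop : Filter ℝ))
    (F := fun r e => (volume (r • U))⁻¹ * volume {s | e.1.2 + s ∈ r • U ∧ e.2.2 + s ∉ r • U})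
    (f := fun _ => 0) (fun _ => 1)
    (hopen.mono fun r hr => (hmeas _ hr).const_mul _)
    (Eventually.of_forall fun r => ae_of_all _ fun e =>
      (mul_le_mul_right (volume_setOf_add_mem_le _ _ _) _).trans
        (ENNReal.inv_mul_le_one _))
    (by rw [lintegral_const, one_mul]; exact measure_ne_top _ _)
    (ae_of_all _ fun e => tendsto_volume_leaving hU hU' hne _ _)
  rw [lintegral_zero] at key
  refine key.congr' ?_
  filter_upwards [hopen] with r hr
  rw [varianceExcess_eq_lintegral hT hstat hL hr, lintegral_const_mul _ (hmeas _ hr)]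

end Evaluation


/-! ### From second moments to asymptotic variances. -/

section Variance

theorem variance_toReal {Ω : Type*} [MeasurableSpace Ω] {P : Measure Ω} [IsProbabilityMeasure P]
    {Y : Ω → ℝ≥0∞} (hY : Measurable Y) (h : ∫⁻ ω, Y ω ^ 2 ∂P ≠ ∞) :
    Var[fun ω => (Y ω).toReal; P] = (∫⁻ ω, Y ω ^ 2 ∂P).toReal - (∫⁻ ω, Y ω ∂P).toReal ^ 2 := by
  have hY2 : Measurable fun ω => Y ω ^ 2 := hY.pow_const 2
  have hae : ∀ᵐ ω ∂P, Y ω ^ 2 < ∞ := ae_lt_top hY2 h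
  have hae' : ∀ᵐ ω ∂P, Y ω < ∞ := hae.mono fun ω hω => by
    rcases eq_or_ne (Y ω) ∞ with h0 | h0
    · simp [h0] at hω
    · exact h0.lt_top
  have hL2 : MemLp (fun ω => (Y ω).toReal) 2 P := by
    rw [memLp_two_iff_integrable_sq hY.ennreal_toReal.aestronglyMeasurable]
    simp_rw [← ENNReal.toReal_pow]
    exact integrable_toReal_of_lintegral_ne_top hY2.aemeasurable h
  rw [variance_eq_sub hL2, integral_toReal hY.aemeasurable hae',
    ← integral_toReal hY2.aemeasurable hae]
  simp [ENNReal.toReal_pow]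

/-- Addition on `EReal` is continuous at `(l, 0)` even for `l = ±∞`, so infinite limits transfer as
well. -/
theorem tendsto_coe_ereal_of_tendsto_sub {ι : Type*} {m : Filter ι} {f g : ι → ℝ}
    (h : Tendsto (fun i => f i - g i) m (𝓝 0)) {l : EReal}
    (hg : Tendsto (fun i => (g i : EReal)) m (𝓝 l)) :
    Tendsto (fun i => (f i : EReal)) m (𝓝 l) := by
  have h0 : Tendsto (fun i => ((f i - g i : ℝ) : EReal)) m (𝓝 ((0 : ℝ) : EReal)) :=
    (continuous_coe_real_ereal.tendsto 0).comp h
  have h1 := (EReal.continuousAt_add (p := (l, ((0 : ℝ) : EReal)))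
    (Or.inr (EReal.coe_ne_bot 0)) (Or.inr (EReal.coe_ne_top 0))).tendsto.comp
    (hg.prodMk_nhds h0)
  simp only [EReal.coe_zero, add_zero] at h1
  refine h1.congr fun i => ?_
  simp only [Function.comp_apply, ← EReal.coe_add, add_sub_cancel]

variable {d : ℕ} {Ω : Type*} [MeasurableSpace Ω] {P : Measure Ω}
  {T : Ω → Measure (Space d × Space d)}

theorem measurable_destination (hT : IsRandomTransport T) (K : Kernel (Ω × Space d) (Space d))
    {B : Set (Space d)} (hB : MeasurableSet B) :
    Measurable fun ω => destination K (source T) ω B := by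
  have h : (fun ω => destination K (source T) ω B) = fun ω =>
      ∫⁻ x, K (ω, x) B ∂((sourceKernel d).comap T hT.measurable ω) := by
    ext ω
    rw [destination_apply K _ ω hB, Kernel.comap_apply, hT.sourceKernel_eq]
  rw [h]
  exact Measurable.lintegral_kernel_prod_right' (f := fun p => K p B) (K.measurable_coe hB)

/-- A convex window need not be Borel, but its boundary is Lebesgue null and, by `hM`, almost surely
null for the destination. The open interior may therefore replace it. -/
theorem normalizedVariance_eq [IsProbabilityMeasure P] (hT : IsRandomTransport T)
    {M : Kernel (Ω × Space d) (Space d)}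
    (hM : ∀ B, MeasurableSet B → volume B = 0 → ∫⁻ ω, destination M (source T) ω B ∂P = 0)
    (hM2 : LocallySquareIntegrable P (destination M (source T)))
    {W : Set (Space d)} (hW : IsWindow W) {r : ℝ} (hr : 0 < r) :
    normalizedVariance P (destination M (source T)) W r =
      ((volume (r • interior W))⁻¹).toReal *
        ((∫⁻ ω, destination M (source T) ω (r • interior W) ^ 2 ∂P).toReal -
          (∫⁻ ω, destination M (source T) ω (r • interior W) ∂P).toReal ^ 2) := by
  have hint : interior (r • W) = r • interior W := (interior_smul₀ hr.ne' W)
  have hopen : IsOpen (r • interior W) := isOpen_interior.smul₀ hr.ne'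
  have hbdd : Bornology.IsBounded (r • interior W) := (hW.2.1.subset interior_subset).smul₀ r
  have hfr : volume (frontier (r • W)) = 0 := (hW.1.smul r).addHaar_frontier volume
  have hmeas := measurable_destination hT M (B := frontier (r • W))
    isClosed_frontier.measurableSet
  have hae : (fun ω => (destination M (source T) ω).real (r • W)) =ᵐ[P]
      fun ω => (destination M (source T) ω (r • interior W)).toReal := by
    filter_upwards [(lintegral_eq_zero_iff hmeas).1 (hM _ isClosed_frontier.measurableSet hfr)]
      with ω hω
    rw [← hint, measureReal_def, measure_congr (interior_ae_eq_of_null_frontier hω)]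
  rw [normalizedVariance, variance_congr hae,
    variance_toReal (measurable_destination hT M hopen.measurableSet)
      (hM2 _ hopen.measurableSet hbdd).ne, ← hint, measureReal_def,
    measure_congr (interior_ae_eq_of_null_frontier hfr), ENNReal.toReal_inv]

theorem locallySquareIntegrable_destination_iff [IsProbabilityMeasure P] (hT : IsRandomTransport T)
    (hstat : IsStationary P T) (hdisc : ∀ᵐ ω ∂P, IsPurelyDiscrete (source T ω))
    (hint : intensity P (source T) < ∞) {L K : Kernel (Ω × Space d) (Space d)}
    [IsMarkovKernel L] [IsMarkovKernel K] (hL : Disintegrates P T L)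
    {F : Kernel (ProbabilityMeasure (Space d)) (ProbabilityMeasure (Space d))} [IsMarkovKernel F]
    (hF1 : MeanValueProperty F) (hindep : CondIndepGiven P T K) (hlaw : HasCondLawGiven P T K L F)
    (hPalm : palmExpectation P (source T) (fun φ => φ {0}) < ∞) :
    LocallySquareIntegrable P (destination K (source T)) ↔
      LocallySquareIntegrable P (destination L (source T)) :=
  ⟨fun h B hB hB' => (lintegral_destination_sq_le hT hdisc hF1 hindep hlaw hB).trans_lt (h B hB hB'), fun h B hB hB' =>
      (lintegral_destination_sq_le_add hT hdisc hF1 hindep hlaw hB).trans_lt (ENNReal.add_lt_top.2 ⟨h B hB hB', varianceExcess_lt_top hT hstat hL hint hPalm hB hB'⟩)⟩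

theorem hasAsymptoticVariance_destination_iff [IsProbabilityMeasure P] (hT : IsRandomTransport T)
    (hstat : IsStationary P T) (hdisc : ∀ᵐ ω ∂P, IsPurelyDiscrete (source T ω))
    (hint : intensity P (source T) < ∞) {L K : Kernel (Ω × Space d) (Space d)}
    [IsMarkovKernel L] [IsMarkovKernel K] (hL : Disintegrates P T L)
    {F : Kernel (ProbabilityMeasure (Space d)) (ProbabilityMeasure (Space d))} [IsMarkovKernel F]
    (hF1 : MeanValueProperty F) (hindep : CondIndepGiven P T K) (hlaw : HasCondLawGiven P T K L F)
    (hPalm : palmExpectation P (source T) (fun φ => φ {0}) < ∞)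
    (hL2 : LocallySquareIntegrable P (destination L (source T))) {W : Set (Space d)}
    (hW : IsWindow W) (l : EReal) :
    HasAsymptoticVariance P (destination K (source T)) W l ↔
      HasAsymptoticVariance P (destination L (source T)) W l := by
  have hle {B : Set (Space d)} (hB : MeasurableSet B) :=
    lintegral_destination_sq_le hT hdisc hF1 hindep hlaw hB
  have hle' {B : Set (Space d)} (hB : MeasurableSet B) :=
    lintegral_destination_sq_le_add hT hdisc hF1 hindep hlaw hB
  have hex {B : Set (Space d)} (hB : MeasurableSet B) (hB' : Bornology.IsBounded B) :=
    varianceExcess_lt_top hT hstat hL hint hPalm hB hB'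
  have hK2 := (locallySquareIntegrable_destination_iff hT hstat hdisc hint hL hF1 hindep hlaw
    hPalm).2 hL2
  have hL0 : ∀ B, MeasurableSet B → volume B = 0 →
      ∫⁻ ω, destination L (source T) ω B ∂P = 0 := fun B hB hB0 =>
    lintegral_destination_eq_zero hT hstat hL hB hB0
  have hmean {B : Set (Space d)} (hB : MeasurableSet B) :=
    lintegral_destination_eq hT hdisc hF1 hlaw hB
  have hK0 : ∀ B, MeasurableSet B → volume B = 0 →
      ∫⁻ ω, destination K (source T) ω B ∂P = 0 := fun B hB hB0 =>
    (hmean hB).trans (hL0 B hB hB0)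
  have hU' : Bornology.IsBounded (interior W) := hW.2.1.subset interior_subset
  have hlim := (ENNReal.tendsto_toReal ENNReal.zero_ne_top).comp
    (tendsto_varianceExcess hT hstat hL hint hPalm isOpen_interior hU' ⟨0, hW.2.2⟩)
  have hbound : ∀ᶠ r : ℝ in atTop,
      0 ≤ normalizedVariance P (destination K (source T)) W r -
        normalizedVariance P (destination L (source T)) W r ∧
      normalizedVariance P (destination K (source T)) W r -
        normalizedVariance P (destination L (source T)) W r ≤
        ((volume (r • interior W))⁻¹ * varianceExcess P T L (r • interior W)).toReal := by
    filter_upwards [eventually_gt_atTop 0] with r hr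
    have hA : MeasurableSet (r • interior W) := (isOpen_interior.smul₀ hr.ne').measurableSet
    have hA' : Bornology.IsBounded (r • interior W) := hU'.smul₀ r
    -- Equal means cancel, leaving only the normalized difference of second moments.
    rw [normalizedVariance_eq hT hK0 hK2 hW hr, normalizedVariance_eq hT hL0 hL2 hW hr, hmean hA,
      ← mul_sub, sub_sub_sub_cancel_right, ENNReal.toReal_mul]
    have h1 := ENNReal.toReal_mono (hK2 _ hA hA').ne (hle hA)
    have h2 := ENNReal.toReal_mono (ENNReal.add_ne_top.2 ⟨(hL2 _ hA hA').ne, (hex hA hA').ne⟩)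
      (hle' hA)
    rw [ENNReal.toReal_add (hL2 _ hA hA').ne (hex hA hA').ne] at h2
    exact ⟨mul_nonneg ENNReal.toReal_nonneg (sub_nonneg.2 h1),
      mul_le_mul_of_nonneg_left (sub_le_iff_le_add'.2 h2) ENNReal.toReal_nonneg⟩
  have hdiff : Tendsto (fun r => normalizedVariance P (destination K (source T)) W r -
      normalizedVariance P (destination L (source T)) W r) atTop (𝓝 0) :=
    tendsto_of_tendsto_of_tendsto_of_le_of_le' tendsto_const_nhds hlim
      (hbound.mono fun r hr => hr.1) (hbound.mono fun r hr => hr.2)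
  have hdiff' : Tendsto (fun r => normalizedVariance P (destination L (source T)) W r -
      normalizedVariance P (destination K (source T)) W r) atTop (𝓝 0) := by
    simpa using hdiff.neg
  exact ⟨tendsto_coe_ereal_of_tendsto_sub hdiff', tendsto_coe_ereal_of_tendsto_sub hdiff⟩

end Variance

end Transport

end

theorem theorem4p3 {d : ℕ} {Ω : Type*} [MeasurableSpace Ω]
    (P : Measure Ω) [IsProbabilityMeasure P]
    (T : Ω → Measure (Transport.Space d × Transport.Space d))
    (hT : Transport.IsRandomTransport T)
    (hstat : Transport.IsStationary P T)
    (hdisc : ∀ᵐ ω ∂P, Transport.IsPurelyDiscrete (Transport.source T ω))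
    (hint : Transport.intensity P (Transport.source T) < ∞)
    (L K : Kernel (Ω × Transport.Space d) (Transport.Space d))
    [IsMarkovKernel L] [IsMarkovKernel K]
    (hL : Transport.Disintegrates P T L)
    (F : Kernel (ProbabilityMeasure (Transport.Space d))
      (ProbabilityMeasure (Transport.Space d)))
    [IsMarkovKernel F]
    (hF1 : Transport.MeanValueProperty F)
    (hF2 : Transport.TranslationCovariant F)
    (hindep : Transport.CondIndepGiven P T K)
    (hlaw : Transport.HasCondLawGiven P T K L F)
    (hPalm : Transport.palmExpectation P (Transport.source T) (fun φ => φ {0}) < ∞) :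
    (Transport.LocallySquareIntegrable P (Transport.destination K (Transport.source T)) ↔
      Transport.LocallySquareIntegrable P (Transport.destination L (Transport.source T))) ∧
    (Transport.LocallySquareIntegrable P (Transport.destination L (Transport.source T)) →
      ∀ W : Set (Transport.Space d), Transport.IsWindow W → ∀ l : EReal,
        (Transport.HasAsymptoticVariance P
            (Transport.destination K (Transport.source T)) W l ↔
          Transport.HasAsymptoticVariance P
            (Transport.destination L (Transport.source T)) W l)) := by
  refine ⟨Transport.locallySquareIntegrable_destination_iff hT hstat hdisc hint hL hF1 hindep hlaw
    hPalm, fun hL2 W hW l => ?_⟩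
  exact Transport.hasAsymptoticVariance_destination_iff hT hstat hdisc hint hL hF1 hindep hlaw
    hPalm hL2 hW l
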